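/- Let $m,d\ge 1$ and consider $m$-layer linear networks $f_{\mathbf w}(x)=W_mW_{m-1}\cdots W_1x$ on $\mathbb R^d$, with square weight matrices $W_1,\dots,W_m\in\mathbb R^{d\times d}$ collected in a vector $\mathbf w\in\mathbb R^{N}$, $N=md^2$. Given samples $(x_i,y_i)_{i=1}^n$ in $\mathbb R^d\times\mathbb R^d$, let $\ell(\mathbf w)=\frac1n\sum_{i=1}^n\|y_i-f_{\mathbf w}(x_i)\|^2$ be the training loss, and put $\Sigma_x=\frac1n\sum_i x_ix_i^{\top}$, $\Sigma_{yx}=\frac1n\sum_i y_ix_i^{\top}$ and, when $\Sigma_x$ is invertible, $T=\Sigma_{yx}\Sigma_x^{-1}$. Let $\Omega\subseteq\mathbb R^N$ be the set of global minima of $\ell$. A widest minimum is an element of $\operatorname{argmin}_{\mathbf w\in\Omega}\lambda_{\max}(\mathbf H_{\mathbf w})$, where $\mathbf H_{\mathbf w}$ is the Hessian of $\ell$ at $\mathbf w$ and $\lambda_{\max}$ denotes the largest eigenvalue. Write $\sigma_{\max}(T)$ for the largest singular value of $T$. Assume that $\Sigma_x=I$ and that all weight matrices are initialized to $I$ (call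 this point $\mathbf w_0$). Then: (i) If gradient flow $\dot{\mathbf w}(t)=-\nabla\ell(\mathbf w(t))$, $t\ge 0$, $\mathbf w(0)=\mathbf w_0$, converges as $t\to\infty$ to a global minimum of $\ell$, then this limit is a widest minimum. (ii) If $T$ is (symmetric) positive definite, then for every step size $\eta>0$ with $$\eta\le\frac1m\min\bigl\{1,\sigma_{\max}(T)^{-2(1-\frac1m)}\bigr\}\qquad\text{and}\qquad \eta\ne\frac1m\,\sigma_{\max}(T)^{-2(1-\frac1m)},$$ gradient descent $\mathbf w_{k+1}=\mathbf w_k-\eta\nabla\ell(\mathbf w_k)$ started at $\mathbf w_0$ converges at a linear rate to a widest minimum: there are a widest minimum $\mathbf w^*$ and constants $C$ and $\rho\in[0,1)$ such that $\|\mathbf w_k-\mathbf w^*\|\le C\rho^k$ for all $k\ge 0$. -/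

import Mathlib

open Filter Topology

noncomputable section

/-- The parameter space `ℝ^N`, `N = m * d * d`, of an `m`-layer linear network all of whose weight
matrices are `d × d`, with its Euclidean structure.  The coordinate `(k, i, j)` is the `(i, j)` entry
of the weight matrix of layer `k` (layers are numbered from `0`). -/
abbrev Params (m d : ℕ) : Type := EuclideanSpace ℝ (Fin m × Fin d × Fin d)

/-- The weight matrix of layer `k`. -/
def layer {m d : ℕ} (w : Params m d) (k : Fin m) : Matrix (Fin d) (Fin d) ℝ :=
  Matrix.of fun i j => w (k, i, j)

/-- The end-to-end matrix: the product of all layers, the last layer being the leftmost factor. -/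
def endToEnd {m d : ℕ} (w : Params m d) : Matrix (Fin d) (Fin d) ℝ :=
  (List.ofFn fun k => layer w k).reverse.prod

/-- The parameters for which every weight matrix is the identity. -/
def identityInit (m d : ℕ) : Params m d :=
  WithLp.toLp 2 fun p => (1 : Matrix (Fin d) (Fin d) ℝ) p.2.1 p.2.2

/-- The quadratic training loss: the empirical mean of `‖y - f_w(x)‖²` over the `n` samples. -/
def trainingLoss (m : ℕ) {n d : ℕ} (x y : Fin n → EuclideanSpace ℝ (Fin d)) (w : Params m d) : ℝ :=
  (n : ℝ)⁻¹ * ∑ i, ‖y i - Matrix.toEuclideanLin (endToEnd w) (x i)‖ ^ 2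

/-- The empirical cross second-order moment of the samples: the mean of `y xᵀ`. -/
def crossMoment {n d : ℕ} (y x : Fin n → EuclideanSpace ℝ (Fin d)) : Matrix (Fin d) (Fin d) ℝ :=
  (n : ℝ)⁻¹ • ∑ i, Matrix.vecMulVec (⇑(y i)) (⇑(x i))

/-- The optimal linear map `T = Σ_yx Σ_x⁻¹`. -/
def optimalMap {n d : ℕ} (x y : Fin n → EuclideanSpace ℝ (Fin d)) : Matrix (Fin d) (Fin d) ℝ :=
  crossMoment y x * (crossMoment x x)⁻¹

/-- The top singular value of a matrix, i.e. its norm as an operator between Euclidean spaces. -/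
def sigmaMax {d : ℕ} (A : Matrix (Fin d) (Fin d) ℝ) : ℝ :=
  ‖Matrix.toEuclideanCLM (n := Fin d) (𝕜 := ℝ) A‖

/-- The set of global minima of a function. -/
def globalMinima {E : Type*} (f : E → ℝ) : Set E :=
  {w | ∀ w', f w ≤ f w'}

/-- The Hessian of `f` at `w`, as a linear operator: the derivative of the gradient. -/
def hessian {E : Type*} [NormedAddCommGroup E] [InnerProductSpace ℝ E] [CompleteSpace E]
    (f : E → ℝ) (w : E) : E →L[ℝ] E :=
  fderiv ℝ (gradient f) w

/-- The sharpness of `f` at `w`: the largest eigenvalue of the Hessian of `f` at `w`. -/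
def sharpness {E : Type*} [NormedAddCommGroup E] [InnerProductSpace ℝ E] [CompleteSpace E]
    (f : E → ℝ) (w : E) : ℝ :=
  sSup {μ : ℝ | Module.End.HasEigenvalue (hessian f w : E →ₗ[ℝ] E) μ}

/-- The set of widest minima: the global minima whose sharpness is minimal among all global
minima. -/
def widestMinima {E : Type*} [NormedAddCommGroup E] [InnerProductSpace ℝ E] [CompleteSpace E]
    (f : E → ℝ) : Set E :=
  {w | w ∈ globalMinima f ∧ ∀ w' ∈ globalMinima f, sharpness f w ≤ sharpness f w'}

/-- `γ` is the gradient flow of `f` on `[0, ∞)` started at `w₀`. -/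
def IsGradientFlow {E : Type*} [NormedAddCommGroup E] [InnerProductSpace ℝ E] [CompleteSpace E]
    (f : E → ℝ) (w₀ : E) (γ : ℝ → E) : Prop :=
  γ 0 = w₀ ∧ ∀ t, 0 ≤ t → HasDerivWithinAt γ (-gradient f (γ t)) (Set.Ici 0) t

/-- The iterates of gradient descent on `f` with step size `η`, started at `w₀`. -/
def gradientDescent {E : Type*} [NormedAddCommGroup E] [InnerProductSpace ℝ E] [CompleteSpace E]
    (f : E → ℝ) (η : ℝ) (w₀ : E) : ℕ → E
  | 0 => w₀
  | k + 1 => gradientDescent f η w₀ k - η • gradient f (gradientDescent f η w₀ k)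

/-- The sequence `u` converges to `a` at a linear (geometric) rate. -/
def ConvergesLinearlyTo {E : Type*} [NormedAddCommGroup E] (u : ℕ → E) (a : E) : Prop :=
  ∃ C ρ : ℝ, 0 ≤ ρ ∧ ρ < 1 ∧ ∀ k, ‖u k - a‖ ≤ C * ρ ^ k

end

/-! For whitened inputs the loss is a constant plus the squared Frobenius distance from the
end-to-end matrix to `T`. Global minima are therefore the exact factorizations of `T`, and the
Hessian there is `2 L* L`, with `L` the derivative of the end-to-end map. Testing `L*` on `u vᵀ`,
for top singular vectors `u`, `v` of `T`, and applying AM-GM over the layers bounds every sharpness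
below by `2 m σ^(2(1-1/m))` (`le_sharpness_trainingLoss`). Balanced minima attain this bound: their
layers share one operator norm `α` with `α^m = σ` (`BalancedLayers.norm_endToEnd`,
`BalancedLayers.sharpness_le`).

For (i), gradient flow conserves balancedness, which is a closed condition and so passes to the
limit.

For (ii), gradient descent from the identity stays among networks with equal layers `Q diag(u) Qᵀ`,
where `Q` diagonalizes `T` (`gradientDescent_eq_diagParams`). Each eigenvalue follows a scalar
recursion with fixed point `s`, the `m`-th root of an eigenvalue of `T`. The step-size condition
rules out oscillation around `s` (`lt_scalarStep_scalarStep`) and makes `s` attracting, so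
convergence is global and linear. The limit has all layers equal to `T^(1/m)`, hence is balanced. -/

/-! ### Convergence of one-dimensional iterations -/

/-- The cluster set `K` is compact and each of its points has a preimage in `K`. Preimages `p'`,
`q'` of its extreme points `p`, `q` must lie across `s`, since `g` moves points towards `s`. Then
`htwo`, which forbids oscillations that do not shrink, rules out `p < s` and afterwards `s < q`. -/
theorem tendsto_of_forall_lt_apply_apply {g : ℝ → ℝ} (hg : Continuous g) {s a b : ℝ} (hs : g s = s)
    {u : ℕ → ℝ} (hu : ∀ k, u k ∈ Set.Icc a b) (hstep : ∀ k, u (k + 1) = g (u k))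
    (hlt : ∀ v ∈ Set.Icc a b, v < s → v < g v) (hgt : ∀ v ∈ Set.Icc a b, s < v → g v < v)
    (htwo : ∀ v ∈ Set.Icc a b, v < s → s < g v → v < g (g v)) :
    Tendsto u atTop (𝓝 s) := by
  set K : Set ℝ := {x | MapClusterPt x atTop u} with hK
  have hKsub : K ⊆ Set.Icc a b := fun x hx =>
    isClosed_Icc.mem_of_frequently_of_tendsto (f := id) (b := 𝓝 x ⊓ map u atTop) (x := x)
      (by
        have : NeBot (𝓝 x ⊓ map u atTop) := hx
        refine Eventually.frequently ?_
        exact (inf_le_right : 𝓝 x ⊓ map u atTop ≤ _) (Filter.Eventually.of_forall hu : ∀ᶠ k in atTop, u k ∈ _))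
      (tendsto_id.mono_left inf_le_left)
  have hKclosed : IsClosed K := isClosed_setOfPred_clusterPt
  have hKcompact : IsCompact K := isCompact_Icc.of_isClosed_subset hKclosed hKsub
  -- Along an ultrafilter on which the shifted orbit tends to `x`, compactness makes the orbit
  -- itself converge; its limit is the preimage.
  have hpred : ∀ x ∈ K, ∃ x' ∈ K, g x' = x := by
    intro x hx
    have hx' : MapClusterPt x atTop (fun k => u (k + 1)) := by
      have : map u atTop = map (fun k => u (k + 1)) atTop := by
        rw [show (fun k => u (k + 1)) = u ∘ (fun k => k + 1) from rfl, ← Filter.map_map,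
          map_add_atTop_eq_nat]
      change ClusterPt x _
      rw [← this]; exact hx
    obtain ⟨U, hU, hUx⟩ := mapClusterPt_iff_ultrafilter.1 hx'
    obtain ⟨x', -, hx'⟩ := isCompact_Icc.ultrafilter_le_nhds' (U.map u)
      (Filter.mem_map.2 (Filter.mem_of_superset univ_mem fun k _ => hu k))
    refine ⟨x', mapClusterPt_iff_ultrafilter.2 ⟨U, hU, hx'⟩, ?_⟩
    have h1 : Tendsto (fun k => g (u k)) U (𝓝 (g x')) :=
      (hg.tendsto x').comp (show Tendsto u U (𝓝 x') from hx')
    have h2 : (fun k => u (k + 1)) = fun k => g (u k) := funext hstep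
    rw [h2] at hUx
    exact tendsto_nhds_unique h1 hUx
  refine isCompact_Icc.tendsto_nhds_of_unique_mapClusterPt (Eventually.of_forall hu) ?_
  intro x _ hxK
  have hne : K.Nonempty := ⟨x, hxK⟩
  obtain ⟨p, hp⟩ := hKcompact.exists_isLeast hne
  obtain ⟨q, hq⟩ := hKcompact.exists_isGreatest hne
  obtain ⟨p', hp', hgp⟩ := hpred p hp.1
  obtain ⟨q', hq', hgq⟩ := hpred q hq.1
  have hqs : s < q → q' < s := by
    intro h
    by_contra! h'
    rcases h'.eq_or_lt with h' | h'
    · subst h'; linarith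
    · linarith [hgt q' (hKsub hq') h', hq.2 hq']
  have hps : p < s → s < p' := by
    intro h
    by_contra! h'
    rcases h'.eq_or_lt with h' | h'
    · subst h'; linarith
    · linarith [hlt p' (hKsub hp') h', hp.2 hp']
  -- Such a `z` is itself an overshoot, from some `v` in `[q', s]`, and `htwo` at `v` gives `v < g
  -- z`.
  have hcross : ∀ z, s < z → z ≤ q → q' ≤ g z := by
    intro z hz hzq
    have hq's := hqs (hz.trans_le hzq)
    obtain ⟨v, hv, hgv⟩ := intermediate_value_Icc' hq's.le hg.continuousOn
      (show z ∈ Set.Icc (g s) (g q') from ⟨by rw [hs]; exact hz.le, by rw [hgq]; exact hzq⟩)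
    have hvs : v < s := lt_of_le_of_ne hv.2 (by rintro rfl; linarith)
    have hvm : v ∈ Set.Icc a b :=
      ⟨(hKsub hq').1.trans hv.1, hvs.le.trans (hz.le.trans (hzq.trans (hKsub hq.1).2))⟩
    have := htwo v hvm hvs (by rw [hgv]; exact hz)
    rw [hgv] at this
    linarith [hv.1]
  have hps' : s ≤ p := by
    by_contra! h
    have h1 := hps h
    have h2 := hcross p' h1 (hq.2 hp')
    have h3 := hqs (h1.trans_le (hq.2 hp'))
    -- Now `p'` is reached from some `v ≥ q' = p`, and the strict inequality `v < g p' = p` is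
    -- absurd.
    have h4 : q' = p := le_antisymm (by linarith) (hp.2 hq')
    obtain ⟨v, hv, hgv⟩ := intermediate_value_Icc' h3.le hg.continuousOn
      (show p' ∈ Set.Icc (g s) (g q') from ⟨by rw [hs]; exact h1.le, by rw [hgq]; exact hq.2 hp'⟩)
    have hvs : v < s := lt_of_le_of_ne hv.2 (by rintro rfl; linarith)
    have hvm : v ∈ Set.Icc a b :=
      ⟨(hKsub hq').1.trans hv.1, hvs.le.trans (h1.le.trans (hKsub hp').2)⟩
    have := htwo v hvm hvs (by rw [hgv]; exact h1)
    rw [hgv] at this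
    linarith [hv.1]
  have hqs' : q ≤ s := by
    by_contra! h
    linarith [hqs h, hp.2 hq']
  exact le_antisymm ((hq.2 hxK).trans hqs') (hps'.trans (hp.2 hxK))

theorem convergesLinearlyTo_of_hasDerivAt {g : ℝ → ℝ} {c s : ℝ} (hg : HasDerivAt g c s)
    (hs : g s = s) (hc : |c| < 1) {u : ℕ → ℝ} (hstep : ∀ k, u (k + 1) = g (u k))
    (hu : Tendsto u atTop (𝓝 s)) : ConvergesLinearlyTo u s := by
  obtain ⟨ρ, hρ, hρ1⟩ := exists_between hc
  have hρ0 : 0 < ρ := (abs_nonneg c).trans_lt hρ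
  have h1 : ∀ᶠ x in 𝓝 s, |g x - s| ≤ ρ * |x - s| := by
    have := (hasDerivAt_iff_isLittleO.1 hg).def (sub_pos.2 hρ)
    filter_upwards [this] with x hx
    rw [hs, smul_eq_mul, Real.norm_eq_abs, Real.norm_eq_abs] at hx
    calc |g x - s| = |(g x - s - (x - s) * c) + (x - s) * c| := by ring_nf
      _ ≤ |g x - s - (x - s) * c| + |(x - s) * c| := abs_add_le _ _
      _ ≤ (ρ - |c|) * |x - s| + |x - s| * |c| := by rw [abs_mul]; linarith
      _ = ρ * |x - s| := by ring
  obtain ⟨N, hN⟩ := eventually_atTop.1 (hu.eventually h1)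
  have h2 : ∀ k, |u (N + k) - s| ≤ |u N - s| * ρ ^ k := by
    intro k
    induction k with
    | zero => simp
    | succ k ih =>
      rw [← add_assoc, hstep]
      calc _ ≤ ρ * |u (N + k) - s| := hN _ (by omega)
        _ ≤ ρ * (|u N - s| * ρ ^ k) := by gcongr
        _ = _ := by ring
  -- The contraction holds only from time `N` on; the sum dominates every ratio up to `N` and so
  -- absorbs the transient.
  refine ⟨∑ j ∈ Finset.range (N + 1), |u j - s| / ρ ^ j, ρ, hρ0.le, hρ1, fun k => ?_⟩
  have hle : ∀ j ≤ N, |u j - s| / ρ ^ j ≤ ∑ j ∈ Finset.range (N + 1), |u j - s| / ρ ^ j :=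
    fun j hj => Finset.single_le_sum (f := fun j => |u j - s| / ρ ^ j)
      (fun i _ => by positivity) (Finset.mem_range.2 (by omega))
  rw [Real.norm_eq_abs]
  rcases le_total k N with hk | hk
  · exact (div_le_iff₀ (by positivity)).1 (hle k hk)
  · obtain ⟨j, rfl⟩ := Nat.exists_eq_add_of_le hk
    calc _ ≤ |u N - s| * ρ ^ j := h2 j
      _ = |u N - s| / ρ ^ N * ρ ^ (N + j) := by rw [pow_add]; field_simp
      _ ≤ _ := by gcongr; exact hle N le_rfl

/-! ### Gradient descent for a deep scalar network -/

/-- The trapezoidal rule overestimates the integral of the convex function `t ^ n` on `[v, w]`. -/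
theorem two_mul_pow_sub_pow_le {v w : ℝ} (hv : 0 ≤ v) (hvw : v ≤ w) (n : ℕ) :
    2 * (w ^ (n + 1) - v ^ (n + 1)) ≤ (n + 1) * (w - v) * (w ^ n + v ^ n) := by
  induction n with
  | zero => simp; linarith
  | succ n ih =>
    have h1 : 0 ≤ (w - v) * (w ^ (n + 1) + v ^ (n + 1) - v * w ^ n - w * v ^ n) := by
      have : w ^ (n + 1) + v ^ (n + 1) - v * w ^ n - w * v ^ n = (w - v) * (w ^ n - v ^ n) := by ring
      rw [this]
      have := pow_le_pow_left₀ hv hvw n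
      have h := sub_nonneg.2 hvw
      exact mul_nonneg h (mul_nonneg h (sub_nonneg.2 this))
    have h2 : (w + v) * (2 * (w ^ (n + 1) - v ^ (n + 1))) ≤
        (w + v) * ((n + 1) * (w - v) * (w ^ n + v ^ n)) :=
      mul_le_mul_of_nonneg_left ih (by linarith)
    have h3 := mul_nonneg (by positivity : (0 : ℝ) ≤ n + 1) h1
    push_cast
    linear_combination (1 / 2) * h2 + (1 / 2) * h3

/-- Gradient descent for the loss `(u ^ (n + 1) - s ^ (n + 1)) ^ 2` of a deep scalar linear network
with `n + 1` layers of common weight `u`, per layer. -/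
def scalarStep (η : ℝ) (n : ℕ) (s u : ℝ) : ℝ :=
  u - 2 * η * (u ^ n * (u ^ (n + 1) - s ^ (n + 1)))

section scalarStep
variable {η s : ℝ} {n : ℕ}

theorem continuous_scalarStep : Continuous (scalarStep η n s) := by
  unfold scalarStep; fun_prop

theorem scalarStep_self : scalarStep η n s s = s := by simp [scalarStep]

/-- The multiplier lies in `(-1, 1)` exactly when `0 < η (n + 1) s^(2n) < 1`; this is where the
excluded step size matters. -/
theorem hasDerivAt_scalarStep :
    HasDerivAt (scalarStep η n s) (1 - 2 * (η * (n + 1) * s ^ (2 * n))) s := by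
  have h := (hasDerivAt_id s).sub ((((hasDerivAt_pow n s).mul
    ((hasDerivAt_pow (n + 1) s).sub_const (s ^ (n + 1)))).const_mul (2 * η)))
  refine h.congr_deriv ?_
  rw [Nat.add_sub_cancel]
  push_cast
  ring

theorem lt_scalarStep (hη : 0 < η) {v : ℝ} (hv : 0 < v) (hvs : v < s) :
    v < scalarStep η n s v := by
  have h1 : v ^ (n + 1) < s ^ (n + 1) := pow_lt_pow_left₀ hvs hv.le (by omega)
  have : 0 < 2 * η * (v ^ n * (s ^ (n + 1) - v ^ (n + 1))) :=
    mul_pos (by positivity) (mul_pos (by positivity) (by linarith))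
  unfold scalarStep; linarith

theorem scalarStep_lt (hη : 0 < η) (hs : 0 < s) {w : ℝ} (hw : s < w) :
    scalarStep η n s w < w := by
  have h1 : s ^ (n + 1) < w ^ (n + 1) := pow_lt_pow_left₀ hw hs.le (by omega)
  have hw0 := hs.trans hw
  have : 0 < 2 * η * (w ^ n * (w ^ (n + 1) - s ^ (n + 1))) :=
    mul_pos (by positivity) (mul_pos (by positivity) (by linarith))
  unfold scalarStep; linarith

/-- Two points on opposite sides of `s` at which the slopes of `(u ^ (n + 1) - s ^ (n + 1)) ^ 2`
are opposite are far apart. -/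
theorem two_mul_slope_le (hs : 0 < s) {v w : ℝ} (hv : 0 < v) (hvs : v < s) (hsw : s < w)
    (h : w ^ n * (w ^ (n + 1) - s ^ (n + 1)) = v ^ n * (s ^ (n + 1) - v ^ (n + 1))) :
    2 * (v ^ n * (s ^ (n + 1) - v ^ (n + 1))) ≤ (n + 1) * s ^ (2 * n) * (w - v) := by
  have hw : 0 < w := hs.trans hsw
  have hvw : v ≤ w := (hvs.trans hsw).le
  set A := w ^ n + v ^ n with hA
  have hA0 : 0 < A := by positivity
  set G := v ^ n * (s ^ (n + 1) - v ^ (n + 1)) with hG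
  -- Weighting the two expressions for the common slope by `v ^ n` and `w ^ n` eliminates `s`.
  have h1 : G * A = (v * w) ^ n * (w ^ (n + 1) - v ^ (n + 1)) := by
    have e : w ^ n * (w ^ (n + 1) - s ^ (n + 1)) * v ^ n + G * w ^ n
        = (v * w) ^ n * (w ^ (n + 1) - v ^ (n + 1)) := by
      rw [hG, mul_pow]; ring
    rw [h] at e
    rw [hA, ← e]; ring
  -- By `h`, `s ^ (n + 1)` is the mean of `w ^ (n + 1)` and `v ^ (n + 1)` with weights `w ^ n`, `v ^
  -- n`. Chebyshev's inequality puts it above the plain mean, and AM-GM then gives `v * w ≤ s ^ 2`.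
  have hcheb : 0 ≤ (w ^ n - v ^ n) * (w ^ (n + 1) - v ^ (n + 1)) :=
    mul_nonneg (sub_nonneg.2 (pow_le_pow_left₀ hv.le hvw n))
      (sub_nonneg.2 (pow_le_pow_left₀ hv.le hvw _))
  have h2 : w ^ (n + 1) + v ^ (n + 1) ≤ 2 * s ^ (n + 1) := by
    refine le_of_mul_le_mul_left ?_ hA0
    have : A * (2 * s ^ (n + 1)) = 2 * (w ^ n * w ^ (n + 1) + v ^ n * v ^ (n + 1)) := by
      rw [hA]; rw [hG] at h; linear_combination -2 * h
    rw [this, hA]; linarith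
  have h3 : v * w ≤ s ^ 2 := by
    have : (v * w) ^ (n + 1) ≤ (s ^ 2) ^ (n + 1) := by
      have e : (s ^ 2) ^ (n + 1) = (s ^ (n + 1)) ^ 2 := by rw [← pow_mul, ← pow_mul, mul_comm]
      rw [e, mul_pow]
      have := pow_pos hv (n + 1)
      have := pow_pos hw (n + 1)
      nlinarith [sq_nonneg (w ^ (n + 1) - v ^ (n + 1))]
    exact (pow_le_pow_iff_left₀ (by positivity) (by positivity) (by omega)).1 this
  have h4 : (v * w) ^ n ≤ s ^ (2 * n) := by
    rw [pow_mul]; exact pow_le_pow_left₀ (by positivity) h3 n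
  refine le_of_mul_le_mul_right ?_ hA0
  have h5 := two_mul_pow_sub_pow_le hv.le hvw n
  have h6 : 0 ≤ w ^ (n + 1) - v ^ (n + 1) := sub_nonneg.2 (pow_le_pow_left₀ hv.le hvw _)
  calc 2 * G * A = (v * w) ^ n * (2 * (w ^ (n + 1) - v ^ (n + 1))) := by rw [mul_assoc, h1]; ring
    _ ≤ s ^ (2 * n) * ((n + 1) * (w - v) * A) := by
        apply mul_le_mul h4 h5 (by linarith) (by positivity)
    _ = _ := by ring

/-- If the step back from `w` reached `v`, some `z` in `(s, w]` would have slope exactly opposite to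
that at `v`. `two_mul_slope_le` would then force `z - v` to exceed the length `2 η G` of the first
step. -/
theorem lt_scalarStep_scalarStep (hη : 0 < η) (hs : 0 < s) (hηs : η * (n + 1) * s ^ (2 * n) < 1)
    {v : ℝ} (hv : 0 < v) (hvs : v < s) (hsw : s < scalarStep η n s v) :
    v < scalarStep η n s (scalarStep η n s v) := by
  set w := scalarStep η n s v with hw
  set G := v ^ n * (s ^ (n + 1) - v ^ (n + 1)) with hG
  have hGpos : 0 < G :=
    mul_pos (by positivity) (sub_pos.2 (pow_lt_pow_left₀ hvs hv.le (by omega)))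
  have hwG : w = v + 2 * η * G := by rw [hw, scalarStep, hG]; ring
  suffices h : w ^ n * (w ^ (n + 1) - s ^ (n + 1)) < G by
    have : 2 * η * (w ^ n * (w ^ (n + 1) - s ^ (n + 1))) < 2 * η * G := by gcongr
    rw [scalarStep]; linarith
  by_contra! hle
  have hcont : Continuous fun w : ℝ => w ^ n * (w ^ (n + 1) - s ^ (n + 1)) := by fun_prop
  obtain ⟨z, hz, hzG⟩ := intermediate_value_Icc hsw.le hcont.continuousOn
    (show G ∈ Set.Icc _ _ from ⟨by simpa using hGpos.le, hle⟩)
  have hsz : s < z := lt_of_le_of_ne hz.1 (by rintro rfl; simp at hzG; linarith)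
  have h1 := two_mul_slope_le hs hv hvs hsz hzG
  have h2 : z - v ≤ 2 * η * G := by linarith [hz.2]
  have h3 : ((n : ℝ) + 1) * s ^ (2 * n) * (z - v) ≤ (n + 1) * s ^ (2 * n) * (2 * η * G) := by
    gcongr
  have h4 : η * (n + 1) * s ^ (2 * n) * (2 * G) < 1 * (2 * G) := by gcongr
  rw [← hG] at h1
  linarith

/-- If `scalarStep` is at least `δ` between `s` and `M₀`, its orbits from `[δ, M₀]` are trapped in a
compact interval of positive numbers, hence converge. -/
theorem convergesLinearlyTo_of_le_scalarStep (hη : 0 < η) (hs : 0 < s)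
    (hηs : η * (n + 1) * s ^ (2 * n) < 1) {δ M₀ : ℝ} (hδ : 0 < δ) (hδs : δ ≤ s)
    (hM : ∀ w ∈ Set.Icc s M₀, δ ≤ scalarStep η n s w)
    {u : ℕ → ℝ} (h0 : u 0 ∈ Set.Icc δ M₀) (hstep : ∀ k, u (k + 1) = scalarStep η n s (u k)) :
    ConvergesLinearlyTo u s := by
  set g := scalarStep η n s with hg
  have hcont : Continuous g := continuous_scalarStep
  -- The largest overshoot `g p` from `[δ, s]` supplies the upper end of the trap.
  obtain ⟨p, hp, hmax⟩ := isCompact_Icc.exists_isMaxOn (Set.nonempty_Icc.2 hδs) hcont.continuousOn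
  have hmax' : ∀ v ∈ Set.Icc δ s, g v ≤ g p := fun v hv => hmax hv
  have hsp : s ≤ g p := by
    have := hmax' s ⟨hδs, le_rfl⟩; rwa [hg, scalarStep_self] at this
  have hmem : ∀ k, u k ∈ Set.Icc δ (max M₀ (g p)) := by
    intro k
    induction k with
    | zero => exact ⟨h0.1, h0.2.trans (le_max_left _ _)⟩
    | succ k ih =>
      rw [hstep]
      rcases lt_or_ge (u k) s with hk | hk
      · exact ⟨ih.1.trans (lt_scalarStep hη (hδ.trans_le ih.1) hk).le,
          (hmax' _ ⟨ih.1, hk.le⟩).trans (le_max_right _ _)⟩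
      · rcases hk.eq_or_lt with hk' | hk'
        · rw [← hk', hg, scalarStep_self]; exact ⟨hδs, hsp.trans (le_max_right _ _)⟩
        refine ⟨?_, (scalarStep_lt hη hs hk').le.trans ih.2⟩
        rcases le_max_iff.1 ih.2 with h | h
        · exact hM _ ⟨hk, h⟩
        -- A point in `(s, g p]` is an overshoot from some `v ≥ δ`, so its image stays above `v`.
        · obtain ⟨v, hv, hgv⟩ := intermediate_value_Icc' hp.2 hcont.continuousOn
            (show u k ∈ Set.Icc (g s) (g p) from ⟨by rw [hg, scalarStep_self]; exact hk, h⟩)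
          have hvs : v < s := lt_of_le_of_ne hv.2 (by
            rintro rfl; rw [hg, scalarStep_self] at hgv; linarith)
          have := lt_scalarStep_scalarStep hη hs hηs (hδ.trans_le (hp.1.trans hv.1)) hvs
            (by rw [← hg, hgv]; exact hk')
          rw [← hg, hgv] at this
          exact (hp.1.trans hv.1).trans this.le
  refine convergesLinearlyTo_of_hasDerivAt hasDerivAt_scalarStep scalarStep_self ?_ hstep
    (tendsto_of_forall_lt_apply_apply hcont scalarStep_self hmem hstep
      (fun v hv => lt_scalarStep hη (hδ.trans_le hv.1)) (fun v _ => scalarStep_lt hη hs)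
      (fun v hv => lt_scalarStep_scalarStep hη hs hηs (hδ.trans_le hv.1)))
  rw [abs_lt]
  have : 0 < η * (n + 1) * s ^ (2 * n) := by positivity
  constructor <;> linarith

/-- For `n ≥ 1` the slope contains a factor `w`, and `2 η ≤ 1`, so the step multiplies `w` by a
positive number when `w ≤ 1`. -/
theorem scalarStep_pos (hη1 : η * (n + 1) ≤ 1) (hn : n ≠ 0) (hs : 0 < s) {w : ℝ}
    (hw : w ∈ Set.Icc s 1) : 0 < scalarStep η n s w := by
  have hw0 : 0 < w := hs.trans_le hw.1
  obtain ⟨j, rfl⟩ := Nat.exists_eq_succ_of_ne_zero hn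
  have h2η : 2 * η ≤ 1 := by
    have : (2 : ℝ) ≤ (j.succ : ℝ) + 1 := by push_cast; linarith [(Nat.cast_nonneg j : (0 : ℝ) ≤ j)]
    nlinarith
  have h1 : w ^ j ≤ 1 := pow_le_one₀ hw0.le hw.2
  have h2 : w ^ (j + 1 + 1) ≤ 1 := pow_le_one₀ hw0.le hw.2
  have h3 : 0 < s ^ (j + 1 + 1) := by positivity
  have h4 : 0 ≤ w ^ (j + 1 + 1) - s ^ (j + 1 + 1) :=
    sub_nonneg.2 (pow_le_pow_left₀ hs.le hw.1 _)
  have h5 : 2 * η * (w ^ j * (w ^ (j + 1 + 1) - s ^ (j + 1 + 1))) < 1 := by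
    calc _ ≤ 1 * (1 * (w ^ (j + 1 + 1) - s ^ (j + 1 + 1))) := by gcongr
      _ < 1 := by linarith
  have : scalarStep η (j + 1) s w
      = w * (1 - 2 * η * (w ^ j * (w ^ (j + 1 + 1) - s ^ (j + 1 + 1)))) := by
    rw [scalarStep]; ring
  rw [Nat.succ_eq_add_one, this]
  exact mul_pos hw0 (by linarith)

theorem convergesLinearlyTo_scalarStep (hη : 0 < η) (hη1 : η * (n + 1) ≤ 1) (hs : 0 < s)
    (hηs : η * (n + 1) * s ^ (2 * n) < 1) {u : ℕ → ℝ} (h0 : u 0 = 1)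
    (hstep : ∀ k, u (k + 1) = scalarStep η n s (u k)) : ConvergesLinearlyTo u s := by
  -- With one layer the iterates may leave the positive axis, but the recursion is affine with ratio
  -- `1 - 2 * η`.
  rcases eq_or_ne n 0 with rfl | hn
  · simp only [scalarStep, Nat.cast_zero, zero_add, mul_one, mul_zero, pow_zero, one_mul,
      pow_one] at hstep hηs
    refine ⟨|1 - s|, |1 - 2 * η|, abs_nonneg _, by rw [abs_lt]; constructor <;> linarith,
      fun k => ?_⟩
    induction k with
    | zero => simp [h0]
    | succ k ih =>
      rw [hstep, show u k - 2 * η * (u k - s) - s = (1 - 2 * η) * (u k - s) by ring, norm_mul,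
        pow_succ, ← mul_assoc, mul_comm, Real.norm_eq_abs (1 - 2 * η)]
      gcongr
  · rcases le_or_gt 1 s with h | h
    · refine convergesLinearlyTo_of_le_scalarStep hη hs hηs (M₀ := s) one_pos h ?_
        (by rw [h0]; exact ⟨le_rfl, h⟩) hstep
      intro w hw
      rw [Set.Icc_self, Set.mem_singleton_iff] at hw
      rw [hw, scalarStep_self]; exact h
    · obtain ⟨p, hp, hmin⟩ := isCompact_Icc.exists_isMinOn (Set.nonempty_Icc.2 h.le)
        (continuous_scalarStep (η := η) (n := n) (s := s)).continuousOn
      have hps : scalarStep η n s p ≤ s := by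
        have : scalarStep η n s p ≤ scalarStep η n s s := hmin (⟨le_rfl, h.le⟩ : s ∈ Set.Icc s 1)
        rwa [scalarStep_self] at this
      refine convergesLinearlyTo_of_le_scalarStep hη hs hηs (M₀ := 1)
        (scalarStep_pos hη1 hn hs hp) hps (fun w hw => hmin hw)
        (by rw [h0]; exact ⟨hps.trans h.le, le_rfl⟩) hstep

end scalarStep

/-! ### Gradient and Hessian of nonlinear least squares -/

section LeastSquares
variable {X Y : Type*} [NormedAddCommGroup X] [InnerProductSpace ℝ X] [CompleteSpace X]
  [NormedAddCommGroup Y] [InnerProductSpace ℝ Y] [CompleteSpace Y]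

theorem hasGradientAt_const_add_norm_sub_sq {E : X → Y} {L : X →L[ℝ] Y} {w : X}
    (hE : HasFDerivAt E L w) (c : ℝ) (t : Y) :
    HasGradientAt (fun w => c + ‖E w - t‖ ^ 2)
      ((2 : ℝ) • ContinuousLinearMap.adjoint L (E w - t)) w := by
  rw [hasGradientAt_iff_hasFDerivAt]
  have h := ((hE.sub_const t).norm_sq).const_add c
  refine h.congr_fderiv ?_
  ext v
  simp [ContinuousLinearMap.adjoint_inner_left]

/-- At a zero of the residual, the Hessian of a nonlinear least squares objective is its
Gauss-Newton operator. -/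
theorem hessian_const_add_norm_sub_sq {E : X → Y} {L : X → X →L[ℝ] Y} (hL : Continuous L)
    (hE : ∀ w, HasFDerivAt E (L w) w) (c : ℝ) {t : Y} {w : X} (hw : E w = t) :
    hessian (fun w => c + ‖E w - t‖ ^ 2) w =
      (2 : ℝ) • (ContinuousLinearMap.adjoint (L w) ∘L L w) := by
  have hgrad : gradient (fun w => c + ‖E w - t‖ ^ 2)
      = fun w => (2 : ℝ) • ContinuousLinearMap.adjoint (L w) (E w - t) :=
    funext fun w => (hasGradientAt_const_add_norm_sub_sq (hE w) c t).gradient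
  rw [hessian, hgrad]
  suffices h : HasFDerivAt (fun w => ContinuousLinearMap.adjoint (L w) (E w - t))
      (ContinuousLinearMap.adjoint (L w) ∘L L w) w from (h.const_smul (2 : ℝ)).fderiv
  have h1 : HasFDerivAt (fun w' => ContinuousLinearMap.adjoint (L w) (E w' - t))
      (ContinuousLinearMap.adjoint (L w) ∘L L w) w :=
    (ContinuousLinearMap.adjoint (L w)).hasFDerivAt.comp w ((hE w).sub_const t)
  -- `L` is only assumed continuous, so no product rule: the operator is `o(1)` and the residual
  -- `O(w' - w)`.
  have h2 : HasFDerivAt (fun w' => ContinuousLinearMap.adjoint (L w' - L w) (E w' - t))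
      (0 : X →L[ℝ] X) w := by
    rw [hasFDerivAt_iff_isLittleO]
    have hO : (fun w' => E w' - t) =O[𝓝 w] fun w' => w' - w := by
      simpa [hw] using (hE w).isBigO_sub
    have ho : (fun w' => ‖L w' - L w‖) =o[𝓝 w] fun _ => (1 : ℝ) := by
      rw [Asymptotics.isLittleO_one_iff]
      have : Tendsto (fun w' => ‖L w' - L w‖) (𝓝 w) (𝓝 ‖L w - L w‖) :=
        ((hL.sub continuous_const).norm).tendsto w
      simpa using this
    have := ho.mul_isBigO hO.norm_norm
    refine (Asymptotics.isBigO_of_le _ fun w' => ?_).trans_isLittleO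
      (this.congr_right (g₂ := fun w' => ‖w' - w‖) (by simp)).of_norm_right
    have hb := (ContinuousLinearMap.adjoint (L w' - L w)).le_opNorm (E w' - t)
    rw [LinearIsometryEquiv.norm_map] at hb
    simpa [hw] using hb
  refine (h1.add h2).congr_fderiv (add_zero _) |>.congr_of_eventuallyEq ?_
  refine Eventually.of_forall fun w' => ?_
  simp only [map_sub, Pi.add_apply, sub_apply]
  abel

end LeastSquares

/-! ### Sharpness of a Gauss-Newton Hessian -/

section Sharpness
variable {X Y : Type*} [NormedAddCommGroup X] [InnerProductSpace ℝ X] [FiniteDimensional ℝ X]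
  [NormedAddCommGroup Y] [InnerProductSpace ℝ Y] [FiniteDimensional ℝ Y]
  {f : X → ℝ} {w : X} {L : X →L[ℝ] Y}

theorem sharpness_le_of_norm_apply_le
    (hH : hessian f w = (2 : ℝ) • (ContinuousLinearMap.adjoint L ∘L L)) {b : ℝ} (hb : 0 ≤ b)
    (hLb : ∀ h, ‖L h‖ ^ 2 ≤ b * ‖h‖ ^ 2) : sharpness f w ≤ 2 * b := by
  refine Real.sSup_le ?_ (by positivity)
  intro μ hμ
  obtain ⟨h, hh⟩ := hμ.exists_hasEigenvector
  have h1 : inner ℝ ((hessian f w) h) h = μ * ‖h‖ ^ 2 := by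
    have := hh.apply_eq_smul
    rw [ContinuousLinearMap.coe_coe] at this
    rw [this, real_inner_smul_left, real_inner_self_eq_norm_sq]
  have h2 : inner ℝ ((hessian f w) h) h = 2 * ‖L h‖ ^ 2 := by
    rw [hH]
    simp [real_inner_smul_left, ContinuousLinearMap.adjoint_inner_left]
  have h3 : 0 < ‖h‖ ^ 2 := by have := norm_pos_iff.2 hh.2; positivity
  have h4 := hLb h
  rw [h1] at h2
  refine le_of_mul_le_mul_right ?_ h3
  linarith

/-- The largest eigenvalue is the supremum of Rayleigh quotients. At `h = L* M`, Cauchy-Schwarz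
gives `‖h‖² = ⟪M, L h⟫ ≤ ‖L h‖`. -/
theorem le_sharpness_of_le_norm_adjoint [Nontrivial X]
    (hH : hessian f w = (2 : ℝ) • (ContinuousLinearMap.adjoint L ∘L L)) {M : Y} (hM : ‖M‖ = 1) :
    2 * ‖ContinuousLinearMap.adjoint L M‖ ^ 2 ≤ sharpness f w := by
  set h := ContinuousLinearMap.adjoint L M with hh
  have hquad : ∀ x, inner ℝ ((hessian f w) x) x = 2 * ‖L x‖ ^ 2 := by
    intro x
    rw [hH]
    simp [real_inner_smul_left, ContinuousLinearMap.adjoint_inner_left]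
  have hsymm : (hessian f w : X →ₗ[ℝ] X).IsSymmetric := by
    intro a b
    rw [hH]
    simp [real_inner_smul_left, real_inner_smul_right, ContinuousLinearMap.adjoint_inner_left,
      ContinuousLinearMap.adjoint_inner_right]
  have heig := hsymm.hasEigenvalue_iSup_of_finiteDimensional
  have hbdd : BddAbove {μ : ℝ | Module.End.HasEigenvalue (hessian f w : X →ₗ[ℝ] X) μ} :=
    (Module.End.finite_hasEigenvalue _).bddAbove
  refine le_trans ?_ (le_csSup hbdd heig)
  simp only [ContinuousLinearMap.coe_coe, RCLike.re_to_real, hquad]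
  have hb : BddAbove (Set.range fun x : {v : X // v ≠ 0} => 2 * ‖L x‖ ^ 2 / ‖(x : X)‖ ^ 2) := by
    refine ⟨2 * ‖L‖ ^ 2, ?_⟩
    rintro _ ⟨x, rfl⟩
    have : 0 < ‖(x : X)‖ := norm_pos_iff.2 x.2
    dsimp only
    rw [div_le_iff₀ (by positivity), mul_assoc, ← mul_pow]
    gcongr
    exact L.le_opNorm x
  by_cases h0 : h = 0
  · rw [h0, norm_zero]
    simp only [ne_eq, OfNat.ofNat_ne_zero, not_false_eq_true, zero_pow, mul_zero]
    exact Real.iSup_nonneg fun x => by positivity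
  · refine le_trans ?_ (le_ciSup hb ⟨h, h0⟩)
    have hpos : 0 < ‖h‖ := norm_pos_iff.2 h0
    have h1 : ‖h‖ ^ 2 ≤ ‖L h‖ := by
      have : ‖h‖ ^ 2 = inner ℝ M (L h) := by
        rw [← ContinuousLinearMap.adjoint_inner_left, ← hh, real_inner_self_eq_norm_sq]
      rw [this]
      simpa [hM] using real_inner_le_norm M (L h)
    rw [le_div_iff₀ (by positivity)]
    nlinarith [mul_le_mul h1 h1 (by positivity) (norm_nonneg _)]

end Sharpness

/-! ### Ordered products and their partial products -/

section Products
variable {R : Type*} [Monoid R]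

/-- The product `A (k - 1) * ⋯ * A 0`. -/
def prefixProd (A : ℕ → R) : ℕ → R
  | 0 => 1
  | k + 1 => A k * prefixProd A k

/-- The product `A (k - 1) * ⋯ * A (j + 1)`. -/
def suffixProd (A : ℕ → R) (j : ℕ) : ℕ → R
  | 0 => 1
  | k + 1 => if j < k then A k * suffixProd A j k else 1

theorem suffixProd_succ_of_lt (A : ℕ → R) {j k : ℕ} (h : j < k) :
    suffixProd A j (k + 1) = A k * suffixProd A j k := by simp [suffixProd, h]

theorem suffixProd_succ_self (A : ℕ → R) (j : ℕ) : suffixProd A j (j + 1) = 1 := by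
  simp [suffixProd]

theorem suffixProd_mul_prefixProd (A : ℕ → R) {j k : ℕ} (h : j < k) :
    suffixProd A j k * prefixProd A (j + 1) = prefixProd A k := by
  induction k, h using Nat.le_induction with
  | base => rw [Nat.succ_eq_add_one, suffixProd_succ_self, one_mul]
  | succ k hk ih =>
    rw [suffixProd_succ_of_lt A hk, mul_assoc, ih]; rfl

theorem suffixProd_eq_mul (A : ℕ → R) {j k : ℕ} (h : j + 1 < k) :
    suffixProd A j k = suffixProd A (j + 1) k * A (j + 1) := by
  induction k, h using Nat.le_induction with
  | base =>
    rw [Nat.succ_eq_add_one, suffixProd_succ_self, suffixProd_succ_of_lt A (by omega),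
      suffixProd_succ_self, one_mul, mul_one]
  | succ k hk ih =>
    rw [suffixProd_succ_of_lt A (by omega), suffixProd_succ_of_lt A (by omega), ih, mul_assoc]

theorem prefixProd_const (a : R) (k : ℕ) : prefixProd (fun _ => a) k = a ^ k := by
  induction k with
  | zero => simp [prefixProd]
  | succ k ih => rw [prefixProd, ih, pow_succ']

theorem prefixProd_congr {A B : ℕ → R} {k : ℕ} (h : ∀ j < k, A j = B j) :
    prefixProd A k = prefixProd B k := by
  induction k with
  | zero => rfl
  | succ k ih => rw [prefixProd, prefixProd, h k (by omega), ih fun j hj => h j (by omega)]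

theorem suffixProd_congr {A B : ℕ → R} {j k : ℕ} (h : ∀ i < k, A i = B i) :
    suffixProd A j k = suffixProd B j k := by
  induction k with
  | zero => rfl
  | succ k ih => rw [suffixProd, suffixProd, h k (by omega), ih fun j hj => h j (by omega)]

theorem suffixProd_const (a : R) {j k : ℕ} (h : j < k) :
    suffixProd (fun _ => a) j k = a ^ (k - 1 - j) := by
  induction k, h using Nat.le_induction with
  | base => rw [Nat.succ_eq_add_one, suffixProd_succ_self]; simp
  | succ k hk ih =>
    rw [suffixProd_succ_of_lt _ hk, ih, ← pow_succ']; congr 1; omega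

theorem reverse_ofFn_prod (A : ℕ → R) (k : ℕ) :
    (List.ofFn fun i : Fin k => A i).reverse.prod = prefixProd A k := by
  induction k with
  | zero => simp [prefixProd]
  | succ k ih =>
    rw [List.ofFn_succ_last]
    simp only [List.reverse_append, List.reverse_singleton, List.prod_append, List.prod_singleton,
      Fin.val_castSucc, Fin.val_last, ih]
    rfl

end Products

/-! ### Frobenius and operator norms -/

section Vectorization
variable {d : ℕ}
open scoped Matrix.Norms.L2Operator

/-- The vector of entries of a matrix, with its Euclidean (Frobenius) structure. -/
def vectorize (d : ℕ) :
    Matrix (Fin d) (Fin d) ℝ →ₗ[ℝ] EuclideanSpace ℝ (Fin d × Fin d) where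
  toFun A := WithLp.toLp 2 fun p => A p.1 p.2
  map_add' _ _ := rfl
  map_smul' _ _ := rfl

@[simp] theorem vectorize_apply (A : Matrix (Fin d) (Fin d) ℝ) (p : Fin d × Fin d) :
    vectorize d A p = A p.1 p.2 := rfl

theorem vectorize_injective : Function.Injective (vectorize d) := fun A B h => by
  ext i j
  simpa using congrArg (fun v : EuclideanSpace ℝ (Fin d × Fin d) => v (i, j)) h

theorem inner_vectorize (A B : Matrix (Fin d) (Fin d) ℝ) :
    inner ℝ (vectorize d A) (vectorize d B) = (A.transpose * B).trace := by
  simp only [PiLp.inner_apply, vectorize_apply, RCLike.inner_apply, conj_trivial,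
    Fintype.sum_prod_type, Matrix.trace, Matrix.diag, Matrix.mul_apply, Matrix.transpose_apply]
  rw [Finset.sum_comm]
  simp_rw [mul_comm]

theorem norm_vectorize_sq (A : Matrix (Fin d) (Fin d) ℝ) :
    ‖vectorize d A‖ ^ 2 = ∑ j, ‖WithLp.toLp 2 (fun i => A i j)‖ ^ 2 := by
  simp only [EuclideanSpace.norm_sq_eq, vectorize_apply, Fintype.sum_prod_type]
  rw [Finset.sum_comm]

theorem norm_vectorize_transpose (A : Matrix (Fin d) (Fin d) ℝ) :
    ‖vectorize d A.transpose‖ = ‖vectorize d A‖ := by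
  rw [← sq_eq_sq₀ (norm_nonneg _) (norm_nonneg _)]
  simp only [EuclideanSpace.norm_sq_eq, vectorize_apply, Fintype.sum_prod_type,
    Matrix.transpose_apply]
  rw [Finset.sum_comm]

theorem norm_transpose (A : Matrix (Fin d) (Fin d) ℝ) : ‖A.transpose‖ = ‖A‖ := by
  rw [← Matrix.l2_opNorm_conjTranspose A, Matrix.conjTranspose_eq_transpose_of_trivial]

theorem norm_vectorize_mul_le (A B : Matrix (Fin d) (Fin d) ℝ) :
    ‖vectorize d (A * B)‖ ≤ ‖A‖ * ‖vectorize d B‖ := by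
  refine le_of_sq_le_sq ?_ (by positivity)
  rw [mul_pow, norm_vectorize_sq, norm_vectorize_sq, Finset.mul_sum]
  refine Finset.sum_le_sum fun j _ => ?_
  rw [← mul_pow]
  gcongr
  exact Matrix.l2_opNorm_mulVec A (WithLp.toLp 2 fun i => B i j)

theorem norm_vectorize_mul_le' (A B : Matrix (Fin d) (Fin d) ℝ) :
    ‖vectorize d (A * B)‖ ≤ ‖vectorize d A‖ * ‖B‖ := by
  rw [← norm_vectorize_transpose, Matrix.transpose_mul, mul_comm, ← norm_transpose B,
    ← norm_vectorize_transpose A]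
  exact norm_vectorize_mul_le _ _

theorem norm_vectorize_vecMulVec (u v : EuclideanSpace ℝ (Fin d)) :
    ‖vectorize d (Matrix.vecMulVec u v)‖ = ‖u‖ * ‖v‖ := by
  rw [← sq_eq_sq₀ (norm_nonneg _) (by positivity), mul_pow]
  simp only [EuclideanSpace.norm_sq_eq, vectorize_apply, Fintype.sum_prod_type,
    Matrix.vecMulVec_apply, Real.norm_eq_abs, sq_abs, mul_pow]
  rw [Finset.sum_mul_sum]

/-- Top singular vectors: `v` maximizes `‖A v‖` on the unit sphere and `u` is the normalized image.
-/
theorem exists_inner_mulVec_eq_norm (hd : 0 < d) (A : Matrix (Fin d) (Fin d) ℝ) :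
    ∃ u v : EuclideanSpace ℝ (Fin d), ‖u‖ = 1 ∧ ‖v‖ = 1 ∧
      inner ℝ u (Matrix.toEuclideanLin A v) = ‖A‖ := by
  have : Nonempty (Fin d) := ⟨⟨0, hd⟩⟩
  set T := Matrix.toEuclideanCLM (n := Fin d) (𝕜 := ℝ) A with hT
  obtain ⟨v, hv, hmax⟩ := (isCompact_sphere (0 : EuclideanSpace ℝ (Fin d)) 1).exists_isMaxOn
    (NormedSpace.sphere_nonempty.2 zero_le_one) (T.continuous.norm.continuousOn)
  have hv1 : ‖v‖ = 1 := by simpa using hv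
  have hnorm : ‖T v‖ = ‖T‖ := by
    refine le_antisymm (by simpa [hv1] using T.le_opNorm v) ?_
    refine T.opNorm_le_of_unit_norm (norm_nonneg _) fun z hz => hmax (by simpa using hz)
  change ∃ u v : EuclideanSpace ℝ (Fin d), ‖u‖ = 1 ∧ ‖v‖ = 1 ∧ inner ℝ u (T v) = ‖T‖
  by_cases h0 : T v = 0
  · exact ⟨v, v, hv1, hv1, by rw [← hnorm, h0]; simp⟩
  · have hpos : ‖T v‖ ≠ 0 := norm_ne_zero_iff.2 h0
    refine ⟨‖T v‖⁻¹ • T v, v, by rw [norm_smul, norm_inv, norm_norm, inv_mul_cancel₀ hpos], hv1, ?_⟩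
    rw [real_inner_smul_left, real_inner_self_eq_norm_sq, ← hnorm]
    field_simp

/-- The C*-identity gives equality at exponents `2 ^ k`; splitting `a ^ 2 ^ k` as `a ^ k * a ^ (2 ^
k - k)` transfers it to `k`. -/
theorem norm_pow_le_norm_pow_of_isSelfAdjoint {E : Type*} [NormedRing E] [StarRing E] [CStarRing E]
    [NormOneClass E] {a : E} (ha : IsSelfAdjoint a) (k : ℕ) : ‖a‖ ^ k ≤ ‖a ^ k‖ := by
  rcases eq_or_ne a 0 with rfl | h0
  · cases k <;> simp
  have hpos : 0 < ‖a‖ := norm_pos_iff.2 h0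
  have h1 : ‖a ^ 2 ^ k‖ = ‖a‖ ^ 2 ^ k := by
    simpa using congrArg NNReal.toReal (ha.nnnorm_pow_two_pow k)
  have hk : k ≤ 2 ^ k := Nat.lt_two_pow_self.le
  have h2 : ‖a‖ ^ k * ‖a‖ ^ (2 ^ k - k) ≤ ‖a ^ k‖ * ‖a‖ ^ (2 ^ k - k) := by
    rw [← pow_add, Nat.add_sub_cancel' hk, ← h1]
    calc ‖a ^ 2 ^ k‖ = ‖a ^ k * a ^ (2 ^ k - k)‖ := by rw [← pow_add, Nat.add_sub_cancel' hk]
      _ ≤ ‖a ^ k‖ * ‖a ^ (2 ^ k - k)‖ := norm_mul_le _ _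
      _ ≤ _ := by gcongr; exact norm_pow_le _ _
  exact le_of_mul_le_mul_right h2 (by positivity)

end Vectorization

/-! ### The end-to-end map and its derivative -/

section Network
variable {m d : ℕ}
open scoped Matrix.Norms.L2Operator

/-- The weight matrices as a sequence, continued by identity matrices. -/
def layerSeq (w : Params m d) (k : ℕ) : Matrix (Fin d) (Fin d) ℝ :=
  if h : k < m then layer w ⟨k, h⟩ else 1

theorem layerSeq_fin (w : Params m d) (k : Fin m) : layerSeq w k = layer w k := by
  simp [layerSeq]

theorem endToEnd_eq_prefixProd (w : Params m d) : endToEnd w = prefixProd (layerSeq w) m := by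
  rw [← reverse_ofFn_prod]; simp only [layerSeq_fin]; rfl

/-- The layers as linear functions of the parameters, continued by zero. -/
def layerLin (m d k : ℕ) : Params m d →ₗ[ℝ] Matrix (Fin d) (Fin d) ℝ where
  toFun w := if h : k < m then layer w ⟨k, h⟩ else 0
  map_add' v w := by
    split_ifs
    · ext i j; rfl
    · simp
  map_smul' c w := by
    split_ifs
    · ext i j; rfl
    · simp

theorem layerLin_fin (w : Params m d) (k : Fin m) : layerLin m d k w = layer w k := by
  simp [layerLin]

theorem hasFDerivAt_layerSeq (w : Params m d) (k : ℕ) :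
    HasFDerivAt (fun w => layerSeq w k) (LinearMap.toContinuousLinearMap (layerLin m d k)) w := by
  by_cases h : k < m
  · refine (LinearMap.toContinuousLinearMap (layerLin m d k)).hasFDerivAt.congr_of_eventuallyEq
      (Eventually.of_forall fun w => ?_)
    simp [layerSeq, layerLin, h]
  · have h1 : (fun w : Params m d => layerSeq w k) = fun _ => 1 := by
      funext w; simp [layerSeq, h]
    have h2 : layerLin m d k = 0 := by ext w; simp [layerLin, h]
    rw [h1, h2]
    exact (hasFDerivAt_const _ _).congr_fderiv (by ext; simp)

theorem contDiff_prefixProd_layerSeq (k : ℕ) :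
    ContDiff ℝ 1 fun w : Params m d => prefixProd (layerSeq w) k := by
  induction k with
  | zero => exact contDiff_const
  | succ k ih =>
    refine ContDiff.mul ?_ ih
    have : fderiv ℝ (fun w : Params m d => layerSeq w k)
        = fun _ => LinearMap.toContinuousLinearMap (layerLin m d k) :=
      funext fun w => (hasFDerivAt_layerSeq w k).fderiv
    refine contDiff_one_iff_fderiv.2 ⟨fun w => (hasFDerivAt_layerSeq w k).differentiableAt, ?_⟩
    rw [this]; exact continuous_const

theorem fderiv_prefixProd_layerSeq (w h : Params m d) (k : ℕ) :
    fderiv ℝ (fun w : Params m d => prefixProd (layerSeq w) k) w h =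
      ∑ j ∈ Finset.range k,
        suffixProd (layerSeq w) j k * layerLin m d j h * prefixProd (layerSeq w) j := by
  induction k with
  | zero => simp [prefixProd]
  | succ k ih =>
    have h1 := (hasFDerivAt_layerSeq w k).mul'
      (((contDiff_prefixProd_layerSeq (m := m) (d := d) k).differentiable one_ne_zero) w).hasFDerivAt
    have h2 : (fun w : Params m d => prefixProd (layerSeq w) (k + 1))
      = (fun w => layerSeq w k) * fun w => prefixProd (layerSeq w) k := rfl
    rw [h2, h1.fderiv, Finset.sum_range_succ, suffixProd_succ_self]
    simp only [add_apply, smul_apply, ih, smul_eq_mul, MulOpposite.smul_eq_mul_unop,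
      MulOpposite.unop_op, one_mul, LinearMap.coe_toContinuousLinearMap']
    congr 1
    rw [Finset.mul_sum]
    refine Finset.sum_congr rfl fun j hj => ?_
    rw [suffixProd_succ_of_lt _ (Finset.mem_range.1 hj)]
    simp only [mul_assoc]

/-- The vectorized end-to-end map. -/
def netMap (w : Params m d) : EuclideanSpace ℝ (Fin d × Fin d) := vectorize d (endToEnd w)

/-- The part of the network above layer `j`. -/
def above (w : Params m d) (j : Fin m) : Matrix (Fin d) (Fin d) ℝ := suffixProd (layerSeq w) j m

/-- The part of the network below layer `j`. -/
def below (w : Params m d) (j : Fin m) : Matrix (Fin d) (Fin d) ℝ := prefixProd (layerSeq w) j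

theorem contDiff_netMap : ContDiff ℝ 1 (netMap : Params m d → _) := by
  have : (netMap : Params m d → _) = fun w =>
      LinearMap.toContinuousLinearMap (vectorize d) (prefixProd (layerSeq w) m) := by
    funext w; simp [netMap, endToEnd_eq_prefixProd]
  rw [this]
  exact (ContinuousLinearMap.contDiff _).comp (contDiff_prefixProd_layerSeq m)

theorem fderiv_netMap_apply (w h : Params m d) :
    fderiv ℝ netMap w h = ∑ j, vectorize d (above w j * layer h j * below w j) := by
  have h0 : (netMap : Params m d → _) = fun w =>
      LinearMap.toContinuousLinearMap (vectorize d) (prefixProd (layerSeq w) m) := by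
    funext w; simp [netMap, endToEnd_eq_prefixProd]
  have h1 := (LinearMap.toContinuousLinearMap (vectorize d)).hasFDerivAt.comp w
    (((contDiff_prefixProd_layerSeq (m := m) (d := d) m).differentiable one_ne_zero) w).hasFDerivAt
  rw [h0, show (fun w : Params m d => LinearMap.toContinuousLinearMap (vectorize d)
    (prefixProd (layerSeq w) m)) = (LinearMap.toContinuousLinearMap (vectorize d)) ∘
      fun w => prefixProd (layerSeq w) m from rfl, h1.fderiv]
  simp only [ContinuousLinearMap.comp_apply, fderiv_prefixProd_layerSeq,
    LinearMap.coe_toContinuousLinearMap', Finset.sum_range, map_sum, layerLin_fin]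
  rfl

theorem inner_params (v w : Params m d) :
    inner ℝ v w = ∑ j, inner ℝ (vectorize d (layer v j)) (vectorize d (layer w j)) := by
  simp only [PiLp.inner_apply, Fintype.sum_prod_type]
  rfl

theorem norm_params_sq (w : Params m d) : ‖w‖ ^ 2 = ∑ j, ‖vectorize d (layer w j)‖ ^ 2 := by
  simp only [← real_inner_self_eq_norm_sq, inner_params]

/-- The parameters with prescribed layers. -/
def ofLayers (A : Fin m → Matrix (Fin d) (Fin d) ℝ) : Params m d :=
  WithLp.toLp 2 fun p => A p.1 p.2.1 p.2.2

@[simp] theorem layer_ofLayers (A : Fin m → Matrix (Fin d) (Fin d) ℝ) (j : Fin m) :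
    layer (ofLayers A) j = A j := rfl

theorem layer_injective {v w : Params m d} (h : ∀ j, layer v j = layer w j) : v = w := by
  ext ⟨j, a, b⟩
  exact congrFun (congrFun (h j) a) b

/-- Cyclicity of the trace moves the outer factors of each derivative term onto `M`. -/
theorem layer_adjoint_fderiv_netMap (w : Params m d) (M : Matrix (Fin d) (Fin d) ℝ) (j : Fin m) :
    layer (ContinuousLinearMap.adjoint (fderiv ℝ netMap w) (vectorize d M)) j =
      (above w j).transpose * M * (below w j).transpose := by
  suffices h : ContinuousLinearMap.adjoint (fderiv ℝ netMap w) (vectorize d M) =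
      ofLayers fun j => (above w j).transpose * M * (below w j).transpose by rw [h, layer_ofLayers]
  refine ext_inner_right ℝ fun h => ?_
  rw [ContinuousLinearMap.adjoint_inner_left, fderiv_netMap_apply, inner_sum, inner_params]
  refine Finset.sum_congr rfl fun j _ => ?_
  rw [inner_vectorize, inner_vectorize, layer_ofLayers]
  simp only [Matrix.transpose_mul, Matrix.transpose_transpose]
  rw [Matrix.mul_assoc (below w j), Matrix.trace_mul_comm (below w j)]
  simp only [Matrix.mul_assoc]

end Network

/-! ### The whitened training loss -/

section Loss
variable {m n d : ℕ} {x y : Fin n → EuclideanSpace ℝ (Fin d)}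

theorem optimalMap_eq_crossMoment (hx : crossMoment x x = 1) :
    optimalMap x y = crossMoment y x := by
  rw [optimalMap, hx, inv_one, mul_one]

theorem crossMoment_apply (y x : Fin n → EuclideanSpace ℝ (Fin d)) (a b : Fin d) :
    crossMoment y x a b = (n : ℝ)⁻¹ * ∑ i, y i a * x i b := by
  simp [crossMoment, Matrix.sum_apply, Matrix.vecMulVec_apply]

/-- For whitened inputs the loss is, up to a constant, the squared distance to the optimal map. -/
theorem trainingLoss_eq_const_add (hx : crossMoment x x = 1) :
    ∃ c : ℝ, trainingLoss m x y =
      fun w => c + ‖netMap w - vectorize d (optimalMap x y)‖ ^ 2 := by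
  refine ⟨(n : ℝ)⁻¹ * ∑ i, ‖y i‖ ^ 2 - ‖vectorize d (optimalMap x y)‖ ^ 2, ?_⟩
  funext w
  rw [optimalMap_eq_crossMoment hx, trainingLoss, netMap, norm_sub_sq_real]
  generalize endToEnd w = W
  have h1 : ∀ i, ‖y i - Matrix.toEuclideanLin W (x i)‖ ^ 2 =
      ‖y i‖ ^ 2 - 2 * inner ℝ (y i) (Matrix.toEuclideanLin W (x i))
        + ‖Matrix.toEuclideanLin W (x i)‖ ^ 2 := fun i => norm_sub_sq_real _ _
  have h2 : (n : ℝ)⁻¹ * ∑ i, inner ℝ (y i) (Matrix.toEuclideanLin W (x i)) =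
      inner ℝ (vectorize d W) (vectorize d (crossMoment y x)) := by
    simp only [PiLp.inner_apply, RCLike.inner_apply, conj_trivial, vectorize_apply,
      crossMoment_apply, Fintype.sum_prod_type]
    simp only [Matrix.toLpLin_apply, Matrix.mulVec, dotProduct, Finset.mul_sum, Finset.sum_mul]
    rw [Finset.sum_comm]
    refine Finset.sum_congr rfl fun a _ => ?_
    rw [Finset.sum_comm]
    refine Finset.sum_congr rfl fun b _ => Finset.sum_congr rfl fun i _ => ?_
    ring
  have h3 : (n : ℝ)⁻¹ * ∑ i, ‖Matrix.toEuclideanLin W (x i)‖ ^ 2 = ‖vectorize d W‖ ^ 2 := by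
    have hδ : ∀ b c, (n : ℝ)⁻¹ * ∑ i, x i b * x i c = if b = c then 1 else 0 := fun b c => by
      rw [← crossMoment_apply, hx, Matrix.one_apply]
    simp only [EuclideanSpace.norm_sq_eq, vectorize_apply, Fintype.sum_prod_type,
      Real.norm_eq_abs, sq_abs]
    calc _ = ∑ a, ∑ b, ∑ c, W a b * W a c * ((n : ℝ)⁻¹ * ∑ i, x i b * x i c) := by
          simp only [Matrix.toLpLin_apply, Matrix.mulVec, dotProduct, sq, Finset.mul_sum,
            Finset.sum_mul]
          rw [Finset.sum_comm]
          refine Finset.sum_congr rfl fun a _ => ?_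
          rw [Finset.sum_comm]
          refine Finset.sum_congr rfl fun b _ => ?_
          rw [Finset.sum_comm]
          refine Finset.sum_congr rfl fun c _ => Finset.sum_congr rfl fun i _ => ?_
          ring
      _ = _ := by
          simp only [hδ, mul_ite, mul_one, mul_zero, Finset.sum_ite_eq, Finset.mem_univ, if_true]
          simp only [sq]
  simp only [h1, Finset.sum_add_distrib, Finset.sum_sub_distrib, mul_add, mul_sub, h3,
    ← Finset.mul_sum]
  rw [mul_left_comm, h2]
  ring

variable (m) in
theorem exists_endToEnd_eq (hm : 0 < m) (T : Matrix (Fin d) (Fin d) ℝ) :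
    ∃ w : Params m d, endToEnd w = T := by
  obtain ⟨k, rfl⟩ := Nat.exists_eq_succ_of_ne_zero hm.ne'
  refine ⟨ofLayers fun j => if (j : ℕ) = k then T else 1, ?_⟩
  have h : ∀ j < k, layerSeq (ofLayers fun j : Fin k.succ => if (j : ℕ) = k then T else 1) j = 1 := by
    intro j hj
    rw [layerSeq, dif_pos (by omega), layer_ofLayers, if_neg (by simpa using hj.ne)]
  rw [endToEnd_eq_prefixProd, prefixProd, prefixProd_congr h, prefixProd_const, one_pow, mul_one,
    layerSeq, dif_pos (by omega), layer_ofLayers, if_pos rfl]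

/-- With at least one layer, zero residual is attainable: put `T` in the last layer and identities
below. -/
theorem mem_globalMinima_trainingLoss_iff (hm : 0 < m) (hx : crossMoment x x = 1)
    {w : Params m d} :
    w ∈ globalMinima (trainingLoss m x y) ↔ endToEnd w = optimalMap x y := by
  obtain ⟨c, hc⟩ := trainingLoss_eq_const_add (m := m) (y := y) hx
  rw [hc]
  constructor
  · intro h
    obtain ⟨v, hv⟩ := exists_endToEnd_eq m hm (optimalMap x y)
    have := h v
    simp only [netMap, hv, sub_self, norm_zero] at this
    apply vectorize_injective
    rw [← sub_eq_zero, ← norm_eq_zero, ← sq_eq_zero_iff]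
    nlinarith [sq_nonneg ‖vectorize d (endToEnd w) - vectorize d (optimalMap x y)‖]
  · intro h v
    simp only [netMap, h, sub_self, norm_zero]
    nlinarith [sq_nonneg ‖vectorize d (endToEnd v) - vectorize d (optimalMap x y)‖]

theorem layer_gradient_trainingLoss (hx : crossMoment x x = 1) (w : Params m d) (j : Fin m) :
    layer (gradient (trainingLoss m x y) w) j = (2 : ℝ) • ((above w j).transpose *
      (endToEnd w - optimalMap x y) * (below w j).transpose) := by
  obtain ⟨c, hc⟩ := trainingLoss_eq_const_add (m := m) (y := y) hx
  rw [hc, (hasGradientAt_const_add_norm_sub_sq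
    ((contDiff_netMap.differentiable one_ne_zero) w).hasFDerivAt c _).gradient, netMap, ← map_sub,
    ← layer_adjoint_fderiv_netMap]
  rfl

theorem hessian_trainingLoss (hx : crossMoment x x = 1) {w : Params m d}
    (hw : endToEnd w = optimalMap x y) :
    hessian (trainingLoss m x y) w =
      (2 : ℝ) • (ContinuousLinearMap.adjoint (fderiv ℝ netMap w) ∘L fderiv ℝ netMap w) := by
  obtain ⟨c, hc⟩ := trainingLoss_eq_const_add (m := m) (y := y) hx
  rw [hc]
  exact hessian_const_add_norm_sub_sq (contDiff_netMap.continuous_fderiv one_ne_zero)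
    (fun w => ((contDiff_netMap.differentiable one_ne_zero) w).hasFDerivAt) c
    (by rw [netMap, hw])

end Loss

/-! ### Minimal sharpness and balanced networks -/

theorem nat_mul_le_sum_of_pow_le_prod {m : ℕ} (hm : m ≠ 0) {β : ℝ} (hβ : 0 ≤ β) {z : Fin m → ℝ}
    (hz : ∀ i, 0 ≤ z i) (h : β ^ m ≤ ∏ i, z i) : m * β ≤ ∑ i, z i := by
  have hm0 : (0 : ℝ) < m := by positivity
  have h1 := Real.geom_mean_le_arith_mean_weighted Finset.univ (fun _ => (m : ℝ)⁻¹) z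
    (fun _ _ => by positivity) (by simp [hm]) fun i _ => hz i
  rw [Real.finsetProd_rpow _ _ fun i _ => hz i, ← Finset.mul_sum] at h1
  have h2 : β ≤ (∏ i, z i) ^ (m : ℝ)⁻¹ := by
    rw [← Real.pow_rpow_inv_natCast hβ hm]
    exact Real.rpow_le_rpow (by positivity) h (by positivity)
  calc m * β ≤ m * ((m : ℝ)⁻¹ * ∑ i, z i) := by gcongr; exact h2.trans h1
    _ = _ := by field_simp

section Widest
variable {m n d : ℕ} {x y : Fin n → EuclideanSpace ℝ (Fin d)}
open scoped Matrix.Norms.L2Operator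

theorem inner_toEuclideanLin_transpose (A : Matrix (Fin d) (Fin d) ℝ)
    (u v : EuclideanSpace ℝ (Fin d)) :
    inner ℝ (Matrix.toEuclideanLin A.transpose u) v = inner ℝ u (Matrix.toEuclideanLin A v) := by
  rw [← Matrix.conjTranspose_eq_transpose_of_trivial, Matrix.toEuclideanLin_conjTranspose_eq_adjoint,
    LinearMap.adjoint_inner_left]

/-- Every global minimum has sharpness at least `2 m σ_max(T) ^ (2 (1 - 1 / m))`. -/
theorem le_sharpness_trainingLoss (hm : 0 < m) (hd : 0 < d) (hx : crossMoment x x = 1)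
    {w : Params m d} (hw : endToEnd w = optimalMap x y) {α : ℝ} (hα : 0 ≤ α)
    (hαm : α ^ m = ‖optimalMap x y‖) :
    2 * (m * α ^ (2 * (m - 1))) ≤ sharpness (trainingLoss m x y) w := by
  have : Nonempty (Fin m) := ⟨⟨0, hm⟩⟩
  have : Nonempty (Fin d) := ⟨⟨0, hd⟩⟩
  obtain ⟨u, v, hu, hv, huv⟩ := exists_inner_mulVec_eq_norm hd (optimalMap x y)
  have hM : ‖vectorize d (Matrix.vecMulVec u v)‖ = 1 := by
    rw [norm_vectorize_vecMulVec, hu, hv, one_mul]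
  refine le_trans ?_ (le_sharpness_of_le_norm_adjoint (hessian_trainingLoss hx hw) hM)
  refine mul_le_mul_of_nonneg_left ?_ zero_le_two
  set a : ℕ → ℝ := fun j => ‖Matrix.toEuclideanLin (suffixProd (layerSeq w) j m).transpose u‖ with ha
  set b : ℕ → ℝ := fun j => ‖Matrix.toEuclideanLin (prefixProd (layerSeq w) j) v‖ with hb
  have hlayer : ∀ j : Fin m, ‖vectorize d (layer (ContinuousLinearMap.adjoint (fderiv ℝ netMap w)
      (vectorize d (Matrix.vecMulVec u v))) j)‖ = a j * b j := by
    intro j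
    rw [layer_adjoint_fderiv_netMap, Matrix.mul_vecMulVec, Matrix.vecMulVec_mul,
      Matrix.vecMul_transpose]
    exact norm_vectorize_vecMulVec (WithLp.toLp 2 _) (WithLp.toLp 2 _)
  rw [norm_params_sq]
  simp only [hlayer]
  refine nat_mul_le_sum_of_pow_le_prod hm.ne' (by positivity) (fun i => by positivity) ?_
  rw [Finset.prod_pow, ← pow_mul, mul_comm, pow_mul, hαm, mul_comm, pow_mul,
    Fin.prod_univ_eq_prod_range (fun j => a j * b j) m]
  refine pow_le_pow_left₀ (by positivity) ?_ 2
  -- Cauchy-Schwarz on `⟪u, T v⟫`, with `T` cut just above layer `j`.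
  have hstep : ∀ j < m, ‖optimalMap x y‖ ≤ a j * b (j + 1) := by
    intro j hj
    rw [← huv, ← hw, endToEnd_eq_prefixProd, ← suffixProd_mul_prefixProd _ hj]
    refine le_trans (le_of_eq ?_) (real_inner_le_norm _ _)
    rw [inner_toEuclideanLin_transpose]
    simp [Matrix.toLpLin_apply]
  obtain ⟨k, rfl⟩ := Nat.exists_eq_succ_of_ne_zero hm.ne'
  have ha1 : a k = 1 := by
    simp [ha, suffixProd_succ_self, hu]
  have hb0 : b 0 = 1 := by simp [hb, prefixProd, hv]
  -- Since the end factors are `1`, the product of all `a j * b j` regroups into `m - 1` factors `a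
  -- j * b (j + 1)`.
  rw [Finset.prod_mul_distrib, Finset.prod_range_succ, Finset.prod_range_succ', ha1, hb0, mul_one,
    mul_one, ← Finset.prod_mul_distrib, Nat.succ_sub_one]
  calc ‖optimalMap x y‖ ^ k = ∏ _j ∈ Finset.range k, ‖optimalMap x y‖ := by simp
    _ ≤ _ := Finset.prod_le_prod (fun _ _ => norm_nonneg _)
      fun j hj => hstep j (by have := Finset.mem_range.1 hj; omega)

/-- Consecutive layers have matching Gram matrices. -/
def BalancedLayers (w : Params m d) : Prop :=
  ∀ k, k + 1 < m → (layerSeq w (k + 1)).transpose * layerSeq w (k + 1) =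
    layerSeq w k * (layerSeq w k).transpose

theorem norm_transpose_mul_self (A : Matrix (Fin d) (Fin d) ℝ) :
    ‖A.transpose * A‖ = ‖A‖ ^ 2 := by
  rw [← Matrix.conjTranspose_eq_transpose_of_trivial, Matrix.l2_opNorm_conjTranspose_mul_self, sq]

theorem BalancedLayers.norm_layerSeq {w : Params m d} (hw : BalancedLayers w) {k : ℕ} (hk : k < m) :
    ‖layerSeq w k‖ = ‖layerSeq w 0‖ := by
  induction k with
  | zero => rfl
  | succ k ih =>
    rw [← ih (by omega), ← sq_eq_sq₀ (norm_nonneg _) (norm_nonneg _), ← norm_transpose_mul_self,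
      hw k hk, ← norm_transpose (layerSeq w k), ← norm_transpose_mul_self,
      Matrix.transpose_transpose]

theorem BalancedLayers.gram_mul_prefixProd {w : Params m d} (hw : BalancedLayers w) {k : ℕ} (hk : k < m) :
    (layerSeq w k).transpose * layerSeq w k * prefixProd (layerSeq w) k =
      prefixProd (layerSeq w) k * ((layerSeq w 0).transpose * layerSeq w 0) := by
  induction k with
  | zero => simp [prefixProd]
  | succ k ih =>
    rw [hw k hk, prefixProd, Matrix.mul_assoc, ← Matrix.mul_assoc (layerSeq w k).transpose,
      ih (by omega), Matrix.mul_assoc]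

/-- Balancedness moves each layer's Gram matrix through the layers below it, where it becomes that
of the first layer. -/
theorem BalancedLayers.prefixProd_gram {w : Params m d} (hw : BalancedLayers w) {k : ℕ} (hk : k ≤ m) :
    (prefixProd (layerSeq w) k).transpose * prefixProd (layerSeq w) k =
      ((layerSeq w 0).transpose * layerSeq w 0) ^ k := by
  induction k with
  | zero => simp [prefixProd]
  | succ k ih =>
    have h : (prefixProd (layerSeq w) (k + 1)).transpose * prefixProd (layerSeq w) (k + 1) =
        (prefixProd (layerSeq w) k).transpose *
          ((layerSeq w k).transpose * layerSeq w k * prefixProd (layerSeq w) k) := by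
      simp only [prefixProd, Matrix.transpose_mul, Matrix.mul_assoc]
    rw [h, hw.gram_mul_prefixProd (by omega), ← Matrix.mul_assoc, ih (by omega), pow_succ]

theorem norm_prefixProd_le {R : Type*} [NormedRing R] [NormOneClass R] {A : ℕ → R} {α : ℝ} {k : ℕ}
    (h : ∀ j < k, ‖A j‖ ≤ α) : ‖prefixProd A k‖ ≤ α ^ k := by
  induction k with
  | zero => simp [prefixProd]
  | succ k ih =>
    have hα : 0 ≤ α := (norm_nonneg _).trans (h k (by omega))
    rw [prefixProd, pow_succ']
    exact (norm_mul_le _ _).trans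
      (mul_le_mul (h k (by omega)) (ih fun j hj => h j (by omega)) (norm_nonneg _) hα)

theorem norm_suffixProd_le {R : Type*} [NormedRing R] [NormOneClass R] {A : ℕ → R} {α : ℝ}
    {j k : ℕ} (hjk : j < k) (h : ∀ j < k, ‖A j‖ ≤ α) : ‖suffixProd A j k‖ ≤ α ^ (k - 1 - j) := by
  induction k, hjk using Nat.le_induction with
  | base => rw [Nat.succ_eq_add_one, suffixProd_succ_self]; simp
  | succ k hk ih =>
    have hα : 0 ≤ α := (norm_nonneg _).trans (h k (by omega))
    rw [suffixProd_succ_of_lt A hk, show k + 1 - 1 - j = (k - 1 - j) + 1 by omega, pow_succ']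
    exact (norm_mul_le _ _).trans
      (mul_le_mul (h k (by omega)) (ih fun j hj => h j (by omega)) (norm_nonneg _) hα)

/-- Submultiplicativity gives one inequality. For the other, the end-to-end Gram matrix is the
`m`-th power of a self-adjoint matrix, so no norm is lost. -/
theorem BalancedLayers.norm_endToEnd (hd : 0 < d) {w : Params m d} (hw : BalancedLayers w) :
    ‖layerSeq w 0‖ ^ m = ‖endToEnd w‖ := by
  have : Nonempty (Fin d) := ⟨⟨0, hd⟩⟩
  rw [endToEnd_eq_prefixProd]
  refine le_antisymm ?_ (norm_prefixProd_le fun j hj => (hw.norm_layerSeq hj).le)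
  refine le_of_sq_le_sq ?_ (norm_nonneg _)
  rw [← norm_transpose_mul_self, hw.prefixProd_gram le_rfl, ← pow_mul, mul_comm, pow_mul,
    ← norm_transpose_mul_self]
  refine norm_pow_le_norm_pow_of_isSelfAdjoint ?_ m
  rw [← Matrix.conjTranspose_eq_transpose_of_trivial]
  exact IsSelfAdjoint.star_mul_self _

/-- Perturbing one layer is amplified by at most `α ^ (m - 1)`; Cauchy-Schwarz over the layers
contributes the factor `m`. -/
theorem BalancedLayers.sharpness_le (hm : 0 < m) (hd : 0 < d) (hx : crossMoment x x = 1)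
    {w : Params m d} (hw : endToEnd w = optimalMap x y) (hbal : BalancedLayers w) :
    sharpness (trainingLoss m x y) w ≤ 2 * (m * ‖layerSeq w 0‖ ^ (2 * (m - 1))) := by
  have : Nonempty (Fin d) := ⟨⟨0, hd⟩⟩
  set α := ‖layerSeq w 0‖ with hα
  have hα0 : 0 ≤ α := norm_nonneg _
  refine sharpness_le_of_norm_apply_le (hessian_trainingLoss hx hw) (by positivity) fun h => ?_
  have h1 : ∀ j : Fin m, ‖vectorize d (above w j * layer h j * below w j)‖ ≤
      α ^ (m - 1) * ‖vectorize d (layer h j)‖ := by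
    intro j
    have hS : ‖above w j‖ ≤ α ^ (m - 1 - j) :=
      norm_suffixProd_le j.2 fun i hi => (hbal.norm_layerSeq hi).le
    have hP : ‖below w j‖ ≤ α ^ (j : ℕ) :=
      norm_prefixProd_le fun i hi => (hbal.norm_layerSeq (hi.trans j.2)).le
    calc _ ≤ ‖above w j‖ * ‖vectorize d (layer h j)‖ * ‖below w j‖ :=
          (norm_vectorize_mul_le' _ _).trans (by gcongr; exact norm_vectorize_mul_le _ _)
      _ ≤ α ^ (m - 1 - j) * ‖vectorize d (layer h j)‖ * α ^ (j : ℕ) := by gcongr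
      _ = α ^ (m - 1 - j + j) * ‖vectorize d (layer h j)‖ := by rw [pow_add]; ring
      _ = _ := by rw [show m - 1 - j + j = m - 1 by omega]
  have h2 : ‖fderiv ℝ netMap w h‖ ≤ α ^ (m - 1) * ∑ j, ‖vectorize d (layer h j)‖ := by
    rw [fderiv_netMap_apply, Finset.mul_sum]
    exact (norm_sum_le _ _).trans (Finset.sum_le_sum fun j _ => h1 j)
  have h3 := sq_sum_le_card_mul_sum_sq (s := Finset.univ)
    (f := fun j : Fin m => ‖vectorize d (layer h j)‖)
  rw [Finset.card_univ, Fintype.card_fin] at h3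
  calc ‖fderiv ℝ netMap w h‖ ^ 2 ≤ (α ^ (m - 1) * ∑ j, ‖vectorize d (layer h j)‖) ^ 2 := by
        gcongr
    _ = α ^ (2 * (m - 1)) * (∑ j, ‖vectorize d (layer h j)‖) ^ 2 := by
        rw [mul_pow, ← pow_mul, mul_comm (m - 1)]
    _ ≤ α ^ (2 * (m - 1)) * (m * ∑ j, ‖vectorize d (layer h j)‖ ^ 2) := by gcongr
    _ = _ := by rw [norm_params_sq]; ring

theorem BalancedLayers.mem_widestMinima (hm : 0 < m) (hd : 0 < d) (hx : crossMoment x x = 1)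
    {w : Params m d} (hw : w ∈ globalMinima (trainingLoss m x y)) (hbal : BalancedLayers w) :
    w ∈ widestMinima (trainingLoss m x y) := by
  refine ⟨hw, fun w' hw' => ?_⟩
  rw [mem_globalMinima_trainingLoss_iff hm hx] at hw hw'
  exact (hbal.sharpness_le hm hd hx hw).trans
    (le_sharpness_trainingLoss hm hd hx hw' (norm_nonneg _) (by rw [hbal.norm_endToEnd hd, hw]))

theorem layerLin_eq_layerSeq {k : ℕ} (hk : k < m) (w : Params m d) :
    layerLin m d k w = layerSeq w k := by
  simp [layerLin, layerSeq, hk]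

/-- Both sides are twice the residual between the transposes of the product above layer `k` and the
product through layer `k`. -/
theorem layer_gradient_balance (hx : crossMoment x x = 1) (w : Params m d) {k : ℕ}
    (hk : k + 1 < m) :
    (layerSeq w (k + 1)).transpose * layerLin m d (k + 1) (gradient (trainingLoss m x y) w) =
      layerLin m d k (gradient (trainingLoss m x y) w) * (layerSeq w k).transpose := by
  have h1 := layer_gradient_trainingLoss (y := y) hx w ⟨k + 1, hk⟩
  have h2 := layer_gradient_trainingLoss (y := y) hx w ⟨k, by omega⟩
  rw [← layerLin_fin] at h1 h2
  simp only at h1 h2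
  rw [h1, h2]
  simp only [above, below, suffixProd_eq_mul _ hk, prefixProd, Matrix.transpose_mul,
    Matrix.mul_smul, Matrix.smul_mul, Matrix.mul_assoc]

theorem balancedLayers_identityInit : BalancedLayers (identityInit m d) := by
  have h : ∀ k, layerSeq (identityInit m d) k = 1 := by
    intro k
    rw [layerSeq]
    split_ifs
    · rfl
    · rfl
  intro k _
  simp [h]

/-- Gradient flow preserves the differences of the Gram matrices of consecutive layers. -/
theorem IsGradientFlow.balancedLayers (hx : crossMoment x x = 1) {w₀ : Params m d} (hw₀ : BalancedLayers w₀)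
    {γ : ℝ → Params m d} (hγ : IsGradientFlow (trainingLoss m x y) w₀ γ) {t : ℝ} (ht : 0 ≤ t) :
    BalancedLayers (γ t) := by
  intro k hk
  set f := trainingLoss m x y with hf
  have hlin : ∀ j s, 0 ≤ s → HasDerivWithinAt (fun t => layerLin m d j (γ t))
      (-layerLin m d j (gradient f (γ s))) (Set.Ici 0) s := by
    intro j s hs
    have := (LinearMap.toContinuousLinearMap (layerLin m d j)).hasFDerivAt.comp_hasDerivWithinAt s
      (hγ.2 s hs)
    exact this.congr_deriv (map_neg (layerLin m d j) _)
  let τ := LinearMap.toContinuousLinearMap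
    (Matrix.transposeLinearEquiv (Fin d) (Fin d) ℝ ℝ).toLinearMap
  have hlinT : ∀ j s, 0 ≤ s → HasDerivWithinAt (fun t => (layerLin m d j (γ t)).transpose)
      (-(layerLin m d j (gradient f (γ s))).transpose) (Set.Ici 0) s := by
    intro j s hs
    have := τ.hasFDerivAt.comp_hasDerivWithinAt s (hlin j s hs)
    exact this.congr_deriv (map_neg τ _)
  have hder : ∀ s, 0 ≤ s → HasDerivWithinAt (fun t =>
      (layerLin m d (k + 1) (γ t)).transpose * layerLin m d (k + 1) (γ t) -
        layerLin m d k (γ t) * (layerLin m d k (γ t)).transpose) 0 (Set.Ici 0) s := by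
    intro s hs
    have h1 := ((hlinT (k + 1) s hs).mul (hlin (k + 1) s hs)).sub
      ((hlin k s hs).mul (hlinT k s hs))
    refine h1.congr_deriv ?_
    have hb := layer_gradient_balance (y := y) hx (γ s) hk
    rw [← layerLin_eq_layerSeq hk, ← layerLin_eq_layerSeq (by omega : k < m), ← hf] at hb
    -- The identity and its transpose cancel the four terms of the derivative in pairs.
    have hbT := congrArg Matrix.transpose hb
    simp only [Matrix.transpose_mul, Matrix.transpose_transpose] at hbT
    simp only [neg_mul, mul_neg, hb, hbT]
    abel
  have hconst := constant_of_has_deriv_right_zero (a := 0) (b := t)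
    (fun s hs => (hder s hs.1).continuousWithinAt.mono Set.Icc_subset_Ici_self)
    (fun s hs => (hder s hs.1).mono (Set.Ici_subset_Ici.2 hs.1)) t ⟨ht, le_rfl⟩
  rw [hγ.1] at hconst
  simp only [layerLin_eq_layerSeq hk, layerLin_eq_layerSeq (by omega : k < m)] at hconst
  rw [hw₀ k hk, sub_self] at hconst
  exact sub_eq_zero.1 hconst

theorem isClosed_balancedLayers : IsClosed {w : Params m d | BalancedLayers w} := by
  have hc : ∀ k, Continuous fun w : Params m d => layerSeq w k := fun k =>
    continuous_iff_continuousAt.2 fun w => (hasFDerivAt_layerSeq w k).continuousAt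
  simp only [BalancedLayers, Set.ofPred_forall]
  exact isClosed_iInter fun k => isClosed_iInter fun _ =>
    isClosed_eq ((hc _).matrix_transpose.mul (hc _)) ((hc _).mul (hc _).matrix_transpose)

end Widest

/-! ### Gradient descent in the eigenbasis of `T` -/

section Descent
variable {m n d : ℕ} {x y : Fin n → EuclideanSpace ℝ (Fin d)}
open scoped Matrix.Norms.L2Operator

theorem convergesLinearlyTo_pi {ι : Type*} [Fintype ι] {u : ℕ → ι → ℝ} {s : ι → ℝ}
    (h : ∀ i, ConvergesLinearlyTo (fun k => u k i) (s i)) : ConvergesLinearlyTo u s := by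
  choose C ρ hρ0 hρ1 hC using h
  have hC0 : ∀ i, 0 ≤ C i := fun i => by simpa using (norm_nonneg _).trans (hC i 0)
  obtain ⟨r, hr0, hr1, hr⟩ : ∃ r : ℝ, 0 ≤ r ∧ r < 1 ∧ ∀ i, ρ i ≤ r := by
    rcases isEmpty_or_nonempty ι with h | h
    · exact ⟨0, le_rfl, one_pos, fun i => h.elim i⟩
    · obtain ⟨i, hi⟩ := Finite.exists_max ρ
      exact ⟨ρ i, hρ0 i, hρ1 i, hi⟩
  refine ⟨∑ i, C i, r, hr0, hr1, fun k => ?_⟩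
  have hsum : 0 ≤ ∑ i, C i := Finset.sum_nonneg fun i _ => hC0 i
  refine (pi_norm_le_iff_of_nonneg (by positivity)).2 fun i => ?_
  refine (hC i k).trans ?_
  have h1 : C i ≤ ∑ i, C i := Finset.single_le_sum (fun i _ => hC0 i) (Finset.mem_univ i)
  have h2 := pow_le_pow_left₀ (hρ0 i) (hr i) k
  have h3 := hρ0 i
  gcongr

theorem ConvergesLinearlyTo.map {E F : Type*} [NormedAddCommGroup E] [NormedSpace ℝ E]
    [NormedAddCommGroup F] [NormedSpace ℝ F] (L : E →L[ℝ] F) {u : ℕ → E} {a : E}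
    (h : ConvergesLinearlyTo u a) : ConvergesLinearlyTo (fun k => L (u k)) (L a) := by
  obtain ⟨C, ρ, h0, h1, hC⟩ := h
  refine ⟨‖L‖ * C, ρ, h0, h1, fun k => ?_⟩
  rw [← map_sub, mul_assoc]
  exact (L.le_opNorm _).trans (by gcongr; exact hC k)

/-- A positive definite matrix is orthogonally diagonalizable, with eigenvalues in `(0, ‖T‖]`. -/
theorem Matrix.PosDef.exists_diagonalization {T : Matrix (Fin d) (Fin d) ℝ} (hT : T.PosDef) :
    ∃ (Q : Matrix (Fin d) (Fin d) ℝ) (l : Fin d → ℝ), Q.transpose * Q = 1 ∧ Q * Q.transpose = 1 ∧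
      T = Q * Matrix.diagonal l * Q.transpose ∧ ∀ i, 0 < l i ∧ l i ≤ ‖T‖ := by
  have hH := hT.isHermitian
  refine ⟨hH.eigenvectorUnitary, hH.eigenvalues, ?_, ?_, ?_, fun i => ⟨hT.eigenvalues_pos i, ?_⟩⟩
  · have := Unitary.coe_star_mul_self hH.eigenvectorUnitary
    rwa [Matrix.star_eq_conjTranspose, Matrix.conjTranspose_eq_transpose_of_trivial] at this
  · have := Unitary.coe_mul_star_self hH.eigenvectorUnitary
    rwa [Unitary.coe_star, Matrix.star_eq_conjTranspose, Matrix.conjTranspose_eq_transpose_of_trivial] at this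
  · have := hH.spectral_theorem
    rw [Unitary.conjStarAlgAut_apply, Matrix.star_eq_conjTranspose,
      Matrix.conjTranspose_eq_transpose_of_trivial] at this
    exact this
  · have h := Matrix.l2_opNorm_mulVec T (hH.eigenvectorBasis i)
    rw [hH.mulVec_eigenvectorBasis, hH.eigenvectorBasis.orthonormal.1 i, mul_one] at h
    have h2 : ‖hH.eigenvalues i • hH.eigenvectorBasis i‖ ≤ ‖T‖ := h
    rw [norm_smul, hH.eigenvectorBasis.orthonormal.1 i, mul_one] at h2
    exact (le_abs_self _).trans h2

/-- The parameters all of whose layers equal `Q * diagonal u * Qᵀ`. -/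
def diagParams (m : ℕ) (Q : Matrix (Fin d) (Fin d) ℝ) : (Fin d → ℝ) →ₗ[ℝ] Params m d where
  toFun u := ofLayers fun _ => Q * Matrix.diagonal u * Q.transpose
  map_add' u v := layer_injective fun j => by
    change _ = layer (ofLayers _) j + layer (ofLayers _) j
    simp only [layer_ofLayers, ← Matrix.add_mul, ← Matrix.mul_add, Matrix.diagonal_add]
    rfl
  map_smul' c u := layer_injective fun j => by
    change _ = c • layer (ofLayers _) j
    simp only [layer_ofLayers, Matrix.diagonal_smul, Matrix.mul_smul, Matrix.smul_mul]

theorem layer_diagParams (Q : Matrix (Fin d) (Fin d) ℝ) (u : Fin d → ℝ) (j : Fin m) :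
    layer (diagParams m Q u) j = Q * Matrix.diagonal u * Q.transpose := rfl

theorem layerSeq_diagParams (Q : Matrix (Fin d) (Fin d) ℝ) (u : Fin d → ℝ) {j : ℕ} (hj : j < m) :
    layerSeq (diagParams m Q u) j = Q * Matrix.diagonal u * Q.transpose := by
  rw [layerSeq, dif_pos hj, layer_diagParams]

variable {Q : Matrix (Fin d) (Fin d) ℝ}

theorem conj_diagonal_mul (hQ : Q.transpose * Q = 1) (u v : Fin d → ℝ) :
    Q * Matrix.diagonal u * Q.transpose * (Q * Matrix.diagonal v * Q.transpose) =
      Q * Matrix.diagonal (u * v) * Q.transpose := by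
  calc _ = Q * Matrix.diagonal u * (Q.transpose * Q) * Matrix.diagonal v * Q.transpose := by
        simp only [Matrix.mul_assoc]
    _ = _ := by
        rw [hQ, Matrix.mul_one, Matrix.mul_assoc Q, Matrix.diagonal_mul_diagonal]; rfl

theorem conj_diagonal_pow (hQ : Q.transpose * Q = 1) (hQ' : Q * Q.transpose = 1) (u : Fin d → ℝ)
    (k : ℕ) : (Q * Matrix.diagonal u * Q.transpose) ^ k =
      Q * Matrix.diagonal (u ^ k) * Q.transpose := by
  induction k with
  | zero => simp [hQ']
  | succ k ih => rw [pow_succ, ih, conj_diagonal_mul hQ, pow_succ]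

theorem conj_diagonal_transpose (u : Fin d → ℝ) :
    (Q * Matrix.diagonal u * Q.transpose).transpose = Q * Matrix.diagonal u * Q.transpose := by
  simp [Matrix.transpose_mul, Matrix.mul_assoc]

theorem below_diagParams (hQ : Q.transpose * Q = 1) (hQ' : Q * Q.transpose = 1) (u : Fin d → ℝ)
    (j : Fin m) :
    below (diagParams m Q u) j = Q * Matrix.diagonal (u ^ (j : ℕ)) * Q.transpose := by
  rw [below, prefixProd_congr fun i hi => layerSeq_diagParams Q u (hi.trans j.2),
    prefixProd_const, conj_diagonal_pow hQ hQ']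

theorem above_diagParams (hQ : Q.transpose * Q = 1) (hQ' : Q * Q.transpose = 1) (u : Fin d → ℝ)
    (j : Fin m) :
    above (diagParams m Q u) j = Q * Matrix.diagonal (u ^ (m - 1 - j)) * Q.transpose := by
  rw [above, suffixProd_congr fun i hi => layerSeq_diagParams Q u hi,
    suffixProd_const _ j.2, conj_diagonal_pow hQ hQ']

theorem endToEnd_diagParams (hQ : Q.transpose * Q = 1) (hQ' : Q * Q.transpose = 1)
    (u : Fin d → ℝ) :
    endToEnd (diagParams m Q u) = Q * Matrix.diagonal (u ^ m) * Q.transpose := by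
  rw [endToEnd_eq_prefixProd, prefixProd_congr fun i hi => layerSeq_diagParams Q u hi,
    prefixProd_const, conj_diagonal_pow hQ hQ']

theorem balancedLayers_diagParams (u : Fin d → ℝ) : BalancedLayers (diagParams m Q u) := by
  intro k hk
  rw [layerSeq_diagParams Q u hk, layerSeq_diagParams Q u (by omega), conj_diagonal_transpose]

/-- The family is invariant because all factors commute and the powers above and below any layer
combine to `m - 1`. -/
theorem gradient_diagParams (hx : crossMoment x x = 1) (hQ : Q.transpose * Q = 1)
    (hQ' : Q * Q.transpose = 1) {l : Fin d → ℝ}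
    (hT : optimalMap x y = Q * Matrix.diagonal l * Q.transpose) (u : Fin d → ℝ) :
    gradient (trainingLoss m x y) (diagParams m Q u) =
      diagParams m Q ((2 : ℝ) • (u ^ (m - 1) * (u ^ m - l))) := by
  refine layer_injective fun j => ?_
  have hj : u ^ (m - 1) = u ^ (m - 1 - (j : ℕ)) * u ^ (j : ℕ) := by
    rw [← pow_add]; congr 1; omega
  rw [layer_gradient_trainingLoss hx, above_diagParams hQ hQ', below_diagParams hQ hQ',
    endToEnd_diagParams hQ hQ', hT, layer_diagParams, conj_diagonal_transpose,
    conj_diagonal_transpose, ← Matrix.sub_mul, ← Matrix.mul_sub, Matrix.diagonal_sub,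
    conj_diagonal_mul hQ, conj_diagonal_mul hQ, Matrix.diagonal_smul, Matrix.mul_smul,
    Matrix.smul_mul, hj]
  congr 4
  change _ * (u ^ m - l) * _ = _
  rw [mul_right_comm]

theorem identityInit_eq_diagParams (hQ' : Q * Q.transpose = 1) :
    identityInit m d = diagParams m Q 1 := by
  refine layer_injective fun j => ?_
  rw [layer_diagParams, Matrix.diagonal_one', Matrix.mul_one, hQ']
  rfl

theorem gradientDescent_eq_diagParams (hx : crossMoment x x = 1) (hQ : Q.transpose * Q = 1)
    (hQ' : Q * Q.transpose = 1) {s : Fin d → ℝ} {k : ℕ}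
    (hT : optimalMap x y = Q * Matrix.diagonal (s ^ (k + 1)) * Q.transpose) (η : ℝ) (t : ℕ) :
    gradientDescent (trainingLoss (k + 1) x y) η (identityInit (k + 1) d) t =
      diagParams (k + 1) Q fun i => (scalarStep η k (s i))^[t] 1 := by
  induction t with
  | zero => rw [gradientDescent, identityInit_eq_diagParams hQ']; rfl
  | succ t ih =>
    rw [gradientDescent, ih, gradient_diagParams hx hQ hQ' hT, ← map_smul, ← map_sub]
    congr 1
    funext i
    rw [Function.iterate_succ_apply', scalarStep]
    simp only [Pi.sub_apply, Pi.smul_apply, Pi.mul_apply, Pi.pow_apply, smul_eq_mul,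
      Nat.add_sub_cancel]
    ring

/-- The excluded value makes the bound strict at `σ`, and monotonicity passes it to every smaller
eigenvalue. -/
theorem mul_pow_lt_one_of_le_of_ne {η σ l : ℝ} {k : ℕ} (hη : 0 < η) (hl : 0 < l) (hlσ : l ≤ σ)
    (hle : η ≤ 1 / ((k + 1 : ℕ) : ℝ) * min 1 (σ ^ (-2 * (1 - 1 / ((k + 1 : ℕ) : ℝ)))))
    (hne : η ≠ 1 / ((k + 1 : ℕ) : ℝ) * σ ^ (-2 * (1 - 1 / ((k + 1 : ℕ) : ℝ)))) :
    η * (k + 1) ≤ 1 ∧ η * (k + 1) * (l ^ (((k + 1 : ℕ) : ℝ)⁻¹)) ^ (2 * k) < 1 := by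
  have hσ : 0 < σ := hl.trans_le hlσ
  have hm : (0 : ℝ) < (k : ℝ) + 1 := by positivity
  have hexp : σ ^ (-2 * (1 - 1 / ((k + 1 : ℕ) : ℝ))) =
      ((σ ^ (((k + 1 : ℕ) : ℝ)⁻¹)) ^ (2 * k))⁻¹ := by
    rw [← Real.rpow_natCast, ← Real.rpow_mul hσ.le, ← Real.rpow_neg hσ.le]
    congr 1
    push_cast
    field_simp
    ring
  set τ := (σ ^ (((k + 1 : ℕ) : ℝ)⁻¹)) ^ (2 * k) with hτ
  have hτ0 : 0 < τ := by positivity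
  rw [hexp] at hle hne
  push_cast at hle hne
  have h1 : η ≤ 1 / ((k : ℝ) + 1) * 1 := hle.trans (by gcongr; exact min_le_left _ _)
  have h2 : η < 1 / ((k : ℝ) + 1) * τ⁻¹ :=
    lt_of_le_of_ne (hle.trans (by gcongr; exact min_le_right _ _)) hne
  have h3 : (l ^ (((k + 1 : ℕ) : ℝ)⁻¹)) ^ (2 * k) ≤ τ := by
    rw [hτ]; gcongr
  constructor
  · calc η * (k + 1) ≤ 1 / ((k : ℝ) + 1) * 1 * (k + 1) := by gcongr
      _ = 1 := by field_simp
  · calc _ ≤ η * (k + 1) * τ := by gcongr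
      _ < 1 / ((k : ℝ) + 1) * τ⁻¹ * (k + 1) * τ := by gcongr
      _ = 1 := by field_simp

theorem gradientDescent_convergesLinearlyTo (hm : 0 < m) (hd : 0 < d) (hx : crossMoment x x = 1)
    (hT : (optimalMap x y).PosDef) {η : ℝ} (hη : 0 < η)
    (hle : η ≤ 1 / (m : ℝ) * min 1 (sigmaMax (optimalMap x y) ^ (-2 * (1 - 1 / (m : ℝ)))))
    (hne : η ≠ 1 / (m : ℝ) * sigmaMax (optimalMap x y) ^ (-2 * (1 - 1 / (m : ℝ)))) :
    ∃ w ∈ widestMinima (trainingLoss m x y),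
      ConvergesLinearlyTo (gradientDescent (trainingLoss m x y) η (identityInit m d)) w := by
  obtain ⟨k, rfl⟩ := Nat.exists_eq_add_one_of_ne_zero hm.ne'
  obtain ⟨Q, l, hQ, hQ', hTQ, hl⟩ := hT.exists_diagonalization
  set s : Fin d → ℝ := fun i => l i ^ (((k + 1 : ℕ) : ℝ)⁻¹) with hs
  have hs0 : ∀ i, 0 < s i := fun i => Real.rpow_pos_of_pos (hl i).1 _
  have hsl : s ^ (k + 1) = l := by
    funext i
    exact Real.rpow_inv_natCast_pow (hl i).1.le (by omega)
  rw [← hsl] at hTQ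
  refine ⟨diagParams (k + 1) Q s, (balancedLayers_diagParams s).mem_widestMinima hm hd hx ?_, ?_⟩
  · rw [mem_globalMinima_trainingLoss_iff hm hx, endToEnd_diagParams hQ hQ', hTQ]
  · rw [funext (gradientDescent_eq_diagParams hx hQ hQ' hTQ η)]
    refine ConvergesLinearlyTo.map (LinearMap.toContinuousLinearMap (diagParams (k + 1) Q))
      (convergesLinearlyTo_pi fun i => ?_)
    obtain ⟨h1, h2⟩ := mul_pow_lt_one_of_le_of_ne hη (hl i).1 (hl i).2 hle hne
    exact convergesLinearlyTo_scalarStep hη h1 (hs0 i) h2 rfl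
      fun t => Function.iterate_succ_apply' _ _ _

end Descent

theorem lemma1 {m n d : ℕ} (hm : 0 < m) (hd : 0 < d)
    (x y : Fin n → EuclideanSpace ℝ (Fin d)) (hx : crossMoment x x = 1) :
    (∀ (γ : ℝ → Params m d) (w : Params m d),
      IsGradientFlow (trainingLoss m x y) (identityInit m d) γ →
      Tendsto γ atTop (𝓝 w) →
      w ∈ globalMinima (trainingLoss m x y) →
      w ∈ widestMinima (trainingLoss m x y)) ∧
    ((optimalMap x y).PosDef →
      ∀ η : ℝ, 0 < η →
      η ≤ 1 / (m : ℝ) * min 1 (sigmaMax (optimalMap x y) ^ (-2 * (1 - 1 / (m : ℝ)))) →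
      η ≠ 1 / (m : ℝ) * sigmaMax (optimalMap x y) ^ (-2 * (1 - 1 / (m : ℝ))) →
      ∃ w ∈ widestMinima (trainingLoss m x y),
        ConvergesLinearlyTo
          (gradientDescent (trainingLoss m x y) η (identityInit m d)) w) := by
  refine ⟨fun γ w hγ hlim hw => ?_, fun hT η hη hle hne =>
    gradientDescent_convergesLinearlyTo hm hd hx hT hη hle hne⟩
  refine BalancedLayers.mem_widestMinima hm hd hx hw ?_
  exact isClosed_balancedLayers.mem_of_tendsto hlim ((eventually_ge_atTop 0).mono fun t ht =>
    hγ.balancedLayers hx balancedLayers_identityInit ht)
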